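/- **Setting.** There are $m\ge1$ agents, a finite nonempty set $\mathcal D$ of arms, dimension $d\ge1$ and $T\ge1$ rounds. In round $t$ agent $i$ sees contexts $x_t^i(a)\in\mathbb R^d$, $a\in\mathcal D$, with $\|x_t^i(a)\|_2\le1$ (they may depend on the past), draws an arm $a_t^i$, and observes $y_t^i=\theta^*\cdot x_t^i(a_t^i)+\eta_t^i$, where $\|\theta^*\|_2\le c$ and the $\eta_t^i$ are independent, $\sigma$-sub-Gaussian, and independent of the past and of the arms drawn in round $t$. Agent $i$ has a merit function $f^i:\mathbb R\to\mathbb R$ with $f^i\ge\gamma>0$ and $|f^i(u)-f^i(v)|\le L|u-v|$, $L>0$. Write $\pi_\theta^{i,t}(a)=f^i(\theta\cdot x_t^i(a))/\sum_{a'}f^i(\theta\cdot x_t^i(a'))$. **Algorithm (Priv-FairX-LinUCB).** Let $g=\lceil T/(m d^2\log^2(1+T/d))\rceil$. The agents synchronise at the end of the rounds $\tau_1<\tau_2<\dots$ in $\{1,\dots,T\}$, where $\tau_1=1$, and $\tau_{k+1}=2\tau_k$ if $\tau_k<g$, $\tau_{k+1}=\tau_k+g$ otherwise; let $n$ be their number.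 At a synchronisation in round $s$ agent $j$ sends $\hat U_s^j=\sum_{\tau\le s}x_\tau^j(a_\tau^j)x_\tau^j(a_\tau^j)^\top+H_s^j$ and $\hat u_s^j=\sum_{\tau\le s}y_\tau^jx_\tau^j(a_\tau^j)+h_s^j$, where the privatizer noise $(H,h)$ is independent of all other randomness. If $s$ is the last synchronisation round before $t$, then $V_t^i=\sum_j\hat U_s^j+\sum_{s<\tau<t}x_\tau^i(a_\tau^i)x_\tau^i(a_\tau^i)^\top$ and $b_t^i=\sum_j\hat u_s^j+\sum_{s<\tau<t}y_\tau^ix_\tau^i(a_\tau^i)$; in round $1$, $V_1^i=\lambda I$ and $b_1^i=0$. Put $\hat\theta_t^i=(V_t^i)^{-1}b_t^i$. Agent $i$ chooses $\theta_t^i$ maximising $\sum_a\pi_\theta^{i,t}(a)\,\theta\cdot x_t^i(a)$ over $\{\theta:\|\theta-\hat\theta_t^i\|_{V_t^i}\le\sqrt{\beta_t}\}$ and, independently of the other agents, draws $a_t^i\sim\pi_t^i=\pi_{\theta_t^i}^{i,t}$. Here $$\sqrt{\beta_t}=\sigma\sqrt{2\log\tfrac2\alpha+d\log\Big(\frac{\bar\rho}{\underline\rho}+\frac{t}{d\underline\rho}\Big)}+mc\sqrt{\bar\rho}+mz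 .$$ **Accuracy.** Let $0<\underline\rho\le\bar\rho$ and $\alpha\in(0,1)$. Assume that $\underline\rho,\bar\rho,z$ are $\alpha/(2nm)$-accurate: for each synchronisation round $s$ and each agent $j$, with probability at least $1-\alpha/(2nm)$, $H_s^j$ is symmetric with $\underline\rho I\preceq H_s^j\preceq\bar\rho I$ and $\|h_s^j\|_{(H_s^j)^{-1}}\le z$. Assume also $\lambda\ge m\underline\rho$. **Theorem.** For every $r>0$ there is a constant $C$, depending on $r$ only, such that in this setting, whenever $m\underline\rho\ge r$, for all $\delta\in(0,1)$ and $\nu>1$, with probability at least $1-\alpha-\delta$ the fairness regret $$FR=\frac1m\sum_{i=1}^m\sum_{t=1}^T\sum_{a\in\mathcal D}\big|\pi_{\theta^*}^{i,t}(a)-\pi_t^i(a)\big|$$ of Priv-FairX-LinUCB is at most $$C\sqrt{\log\tfrac4\delta}\cdot\frac{4\nu L\sqrt{\beta_T}}{\gamma}\sqrt{mTd\log\Big(\frac{\bar\rho}{\underline\rho}+\frac{T}{d\underline\rho}\Big)+m^2d^3\log^3\Big(\frac{\bar\rho}{\underline\rho}+\frac{T}{d\underline\rho}\Big)} .$$ 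-/

import Mathlib

open MeasureTheory ProbabilityTheory
open scoped Matrix NNReal

noncomputable section

namespace FairBandit

/-! ### Deterministic ingredients -/

/-- The norm `‖v‖_A = √(vᵀ A v)` given by a positive semidefinite matrix `A`. -/
def matNorm {d : ℕ} (A : Matrix (Fin d) (Fin d) ℝ) (v : Fin d → ℝ) : ℝ :=
  √(v ⬝ᵥ (A *ᵥ v))

/-- The policy proportional to merit: arm `a` gets the probability
`f (θ · x a) / ∑ a', f (θ · x a')`. -/
def meritPolicy {D : Type*} [Fintype D] {d : ℕ} (f : ℝ → ℝ) (x : D → Fin d → ℝ)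
    (θ : Fin d → ℝ) (a : D) : ℝ :=
  f (θ ⬝ᵥ x a) / ∑ a', f (θ ⬝ᵥ x a')

/-- The expected reward under `θ` of the merit policy of `θ`, the objective of the
optimistic choice. -/
def optimisticValue {D : Type*} [Fintype D] {d : ℕ} (f : ℝ → ℝ) (x : D → Fin d → ℝ)
    (θ : Fin d → ℝ) : ℝ :=
  ∑ a, meritPolicy f x θ a * (θ ⬝ᵥ x a)

/-- `f` is a merit function with minimum merit `γ` and Lipschitz constant `L`. -/
structure IsMerit (γ L : ℝ) (f : ℝ → ℝ) : Prop where
  min_merit : ∀ u, γ ≤ f u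
  lipschitz : ∀ u v, |f u - f v| ≤ L * |u - v|

/-- The maximal gap `⌈T / (m d² log² (1 + T/d))⌉` between two synchronisations. -/
def syncGap (m d T : ℕ) : ℕ :=
  ⌈(T : ℝ) / (m * (d : ℝ) ^ 2 * Real.log (1 + (T : ℝ) / d) ^ 2)⌉₊

/-- The successive values of `τ`: it starts at `1`, doubles as long as it is below the
maximal gap, and grows by the maximal gap afterwards. -/
def syncTime (m d T : ℕ) : ℕ → ℕ
  | 0 => 1
  | k + 1 =>
    if syncTime m d T k < syncGap m d T then 2 * syncTime m d T k
    else syncTime m d T k + syncGap m d T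

open Classical in
/-- The rounds in `{1, …, T}` at whose end the agents synchronise. -/
def syncRounds (m d T : ℕ) : Finset ℕ :=
  (Finset.Icc 1 T).filter fun t => ∃ k, syncTime m d T k = t

/-- The last synchronisation round before round `t`; it is `0` if there is none. -/
def lastSync (m d T t : ℕ) : ℕ :=
  ((syncRounds m d T).filter fun s => s < t).sup id

/-- The radius `√β_t` of the confidence ellipsoids of round `t`. -/
def sqrtBeta (m d : ℕ) (σ α c ρlo ρhi z : ℝ) (t : ℕ) : ℝ :=
  σ * √(2 * Real.log (2 / α) + d * Real.log (ρhi / ρlo + t / (d * ρlo)))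
    + m * c * √ρhi + m * z

/-- The perturbation `(H, h)` satisfies the bounds `ρlo`, `ρhi`, `z`: `H` is symmetric positive
definite with `‖H⁻¹‖ ≤ 1 / ρlo` and `‖H‖ ≤ ρhi`, that is, `ρlo I ≼ H ≼ ρhi I`, and
`‖h‖_{H⁻¹} ≤ z`. -/
structure NoiseWithin {d : ℕ} (ρlo ρhi z : ℝ) (H : Matrix (Fin d) (Fin d) ℝ)
    (h : Fin d → ℝ) : Prop where
  lower : (H - ρlo • (1 : Matrix (Fin d) (Fin d) ℝ)).PosSemidef
  upper : (ρhi • (1 : Matrix (Fin d) (Fin d) ℝ) - H).PosSemidef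
  vec : matNorm H⁻¹ h ≤ z

/-! ### Random trajectories -/

/-- The random quantities of a run of the federated bandit with `m` agents in dimension `d`. Rounds
are numbered from `1`. -/
structure Run (Ω D : Type*) (m d : ℕ) where
  /-- `ctx t i a` is the context `x_t^i(a)`. -/
  ctx : ℕ → Fin m → D → Ω → (Fin d → ℝ)
  /-- `act t i` is the arm `a_t^i` that agent `i` draws in round `t`. -/
  act : ℕ → Fin m → Ω → D
  /-- `eta t i` is the noise in the reward that agent `i` observes in round `t`. -/
  eta : ℕ → Fin m → Ω → ℝ
  /-- `H s j` is the privatizer's perturbation of the Gram matrix that agent `j` sends at the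
  synchronisation in round `s`. -/
  H : ℕ → Fin m → Ω → Matrix (Fin d) (Fin d) ℝ
  /-- `h s j` is the privatizer's perturbation of the reward vector that agent `j` sends at the
  synchronisation in round `s`. -/
  h : ℕ → Fin m → Ω → (Fin d → ℝ)
  /-- `theta t i` is the optimistic parameter `θ_t^i` chosen by agent `i` in round `t`. -/
  theta : ℕ → Fin m → Ω → (Fin d → ℝ)

namespace Run

variable {Ω D : Type*} {m d : ℕ} (R : Run Ω D m d)

/-- The context `x_t^i(a_t^i)` of the arm that is drawn. -/
def chosen (t : ℕ) (i : Fin m) (ω : Ω) : Fin d → ℝ :=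
  R.ctx t i (R.act t i ω) ω

/-- The observed reward `y_t^i = θ* · x_t^i(a_t^i) + η_t^i`. -/
def reward (θstar : Fin d → ℝ) (t : ℕ) (i : Fin m) (ω : Ω) : ℝ :=
  θstar ⬝ᵥ R.chosen t i ω + R.eta t i ω

/-- The perturbed Gram matrix that agent `j` communicates at a synchronisation in round `s`. -/
def privGram (s : ℕ) (j : Fin m) (ω : Ω) : Matrix (Fin d) (Fin d) ℝ :=
  (∑ τ ∈ Finset.Icc 1 s, Matrix.vecMulVec (R.chosen τ j ω) (R.chosen τ j ω)) + R.H s j ω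

/-- The perturbed reward vector that agent `j` communicates at a synchronisation in round `s`. -/
def privVec (θstar : Fin d → ℝ) (s : ℕ) (j : Fin m) (ω : Ω) : Fin d → ℝ :=
  (∑ τ ∈ Finset.Icc 1 s, R.reward θstar τ j ω • R.chosen τ j ω) + R.h s j ω

/-- The matrix `V_t^i`: the shared part of the last synchronisation (`lam • I` before the first
one) plus agent `i`'s own exact observations since then. -/
def V (T : ℕ) (lam : ℝ) (t : ℕ) (i : Fin m) (ω : Ω) : Matrix (Fin d) (Fin d) ℝ :=
  (if lastSync m d T t = 0 then lam • (1 : Matrix (Fin d) (Fin d) ℝ)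
    else ∑ j, R.privGram (lastSync m d T t) j ω)
  + ∑ τ ∈ Finset.Ico (lastSync m d T t + 1) t,
      Matrix.vecMulVec (R.chosen τ i ω) (R.chosen τ i ω)

/-- The vector `b_t^i`, built like `V_t^i`. -/
def b (T : ℕ) (θstar : Fin d → ℝ) (t : ℕ) (i : Fin m) (ω : Ω) : Fin d → ℝ :=
  (if lastSync m d T t = 0 then 0
    else ∑ j, R.privVec θstar (lastSync m d T t) j ω)
  + ∑ τ ∈ Finset.Ico (lastSync m d T t + 1) t, R.reward θstar τ i ω • R.chosen τ i ω

/-- The estimate `(V_t^i)⁻¹ b_t^i` of `θ*`. -/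
def thetaHat (T : ℕ) (lam : ℝ) (θstar : Fin d → ℝ) (t : ℕ) (i : Fin m) (ω : Ω) : Fin d → ℝ :=
  (R.V T lam t i ω)⁻¹ *ᵥ R.b T θstar t i ω

/-- The confidence ellipsoid of agent `i` in round `t`, with radius `rad`. -/
def confRegion (T : ℕ) (lam : ℝ) (θstar : Fin d → ℝ) (rad : ℝ) (t : ℕ) (i : Fin m) (ω : Ω) :
    Set (Fin d → ℝ) :=
  {θ | matNorm (R.V T lam t i ω) (θ - R.thetaHat T lam θstar t i ω) ≤ rad}

/-- The policy `π_t^i`. -/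
def policy [Fintype D] (f : Fin m → ℝ → ℝ) (t : ℕ) (i : Fin m) (ω : Ω) (a : D) : ℝ :=
  meritPolicy (f i) (fun a' => R.ctx t i a' ω) (R.theta t i ω) a

/-- The fair policy `π_*^i` in round `t`. -/
def optPolicy [Fintype D] (f : Fin m → ℝ → ℝ) (θstar : Fin d → ℝ) (t : ℕ) (i : Fin m) (ω : Ω)
    (a : D) : ℝ :=
  meritPolicy (f i) (fun a' => R.ctx t i a' ω) θstar a

/-- The fairness regret of agent `i` in round `t`. -/
def instRegret [Fintype D] (f : Fin m → ℝ → ℝ) (θstar : Fin d → ℝ) (t : ℕ) (i : Fin m)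
    (ω : Ω) : ℝ :=
  ∑ a, |R.optPolicy f θstar t i ω a - R.policy f t i ω a|

/-- The fairness regret over `T` rounds, averaged over the agents. -/
def fairnessRegret [Fintype D] (f : Fin m → ℝ → ℝ) (θstar : Fin d → ℝ) (T : ℕ) (ω : Ω) : ℝ :=
  1 / (m : ℝ) * ∑ i, ∑ t ∈ Finset.Icc 1 T, R.instRegret f θstar t i ω

/-- `R` is a run over `T` rounds of Priv-FairX-LinUCB with initial regularisation `lam` and radii
`rad t`, in the linear bandit with parameter `θstar` and independent `σ`-sub-Gaussian reward noise.
`ℱ t` is all that is determined when the arms of round `t` are about to be drawn: the history, the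
contexts of round `t`, and the random numbers of the privatizer, which are drawn independently of
everything else. The contexts may be chosen adaptively. -/
structure IsPrivFairX [Fintype D] [mΩ : MeasurableSpace Ω] (P : Measure Ω) (ℱ : Filtration ℕ mΩ)
    (T : ℕ) (lam : ℝ) (f : Fin m → ℝ → ℝ) (θstar : Fin d → ℝ) (σ : ℝ≥0) (rad : ℕ → ℝ) :
    Prop where
  meas_H : ∀ s ∈ Finset.Icc 1 T, ∀ j k l, Measurable[ℱ 0] fun ω => R.H s j ω k l
  meas_h : ∀ s ∈ Finset.Icc 1 T, ∀ j, Measurable[ℱ 0] (R.h s j)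
  meas_ctx : ∀ t ∈ Finset.Icc 1 T, ∀ i a, Measurable[ℱ t] (R.ctx t i a)
  meas_theta : ∀ t ∈ Finset.Icc 1 T, ∀ i, Measurable[ℱ t] (R.theta t i)
  meas_act : ∀ t ∈ Finset.Icc 1 T, ∀ i, Measurable[ℱ (t + 1), ⊤] (R.act t i)
  meas_eta : ∀ t ∈ Finset.Icc 1 T, ∀ i, Measurable[ℱ (t + 1)] (R.eta t i)
  /-- `θ_t^i` maximises the objective over the confidence ellipsoid (which is one if `V_t^i` is
  positive definite). -/
  optimistic : ∀ t ∈ Finset.Icc 1 T, ∀ i ω, (R.V T lam t i ω).PosDef →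
    R.theta t i ω ∈ R.confRegion T lam θstar (rad t) t i ω ∧
    IsMaxOn (optimisticValue (f i) fun a => R.ctx t i a ω)
      (R.confRegion T lam θstar (rad t) t i ω) (R.theta t i ω)
  /-- In each round the agents draw their arms independently, agent `i` from `π_t^i`. -/
  sampling : ∀ t ∈ Finset.Icc 1 T, ∀ arms : Fin m → D,
    P[Set.indicator {ω | ∀ i, R.act t i ω = arms i} (fun _ => (1 : ℝ)) | ℱ t]
      =ᵐ[P] fun ω => ∏ i, R.policy f t i ω (arms i)
  noise_subgaussian : ∀ t ∈ Finset.Icc 1 T, ∀ i, HasSubgaussianMGF (R.eta t i) (σ ^ 2) P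
  noise_indep : ∀ t ∈ Finset.Icc 1 T, iIndepFun (fun i => R.eta t i) P
  noise_indep_past : ∀ t ∈ Finset.Icc 1 T,
    Indep (⨆ i, MeasurableSpace.comap (R.eta t i) inferInstance)
      (ℱ t ⊔ MeasurableSpace.comap (fun ω i => R.act t i ω) ⊤) P

/-- `ρlo`, `ρhi` and `z` are `κ`-accurate for the privatizer noise: for each synchronisation round
and each agent, the noise stays within these bounds with probability at least `1 - κ`. -/
def NoiseAccurate [MeasurableSpace Ω] (P : Measure Ω) (T : ℕ) (ρlo ρhi z κ : ℝ) : Prop :=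
  ∀ s ∈ syncRounds m d T, ∀ j,
    1 - κ ≤ P.real {ω | NoiseWithin ρlo ρhi z (R.H s j ω) (R.h s j ω)}

end Run

end FairBandit

end

noncomputable section

namespace FairBandit

/-! ### Quadratic forms -/

section Quadratic

variable {d : ℕ} {A B : Matrix (Fin d) (Fin d) ℝ}

/-! Each agent is analysed as if it learned alone. Write ρ for `ρlo`. After round 1 the matrix V of
agent i dominates W = mρ I + its own exact Gram matrix, because the m perturbations sum to at least
mρ I; in round 1 itself V = λ I does so by the choice of λ. The price is a factor √m in the
confidence radius. The elliptic potential of one agent is of order √(T d log), and √m times it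
already matches the term mTd log under the root; the cubic term is slack.

Confidence. Let e be the estimation error. Then V e consists of noise sums, the vectors h_j and the
biases H_j θ*. As H_j ≼ V, duality bounds the last two kinds by mz and mc√ρhi. The noise sum S_j of
agent j is measured in G_j = ρ I + its Gram matrix. At a synchronisation Σ_j G_j ≼ V, so
Cauchy-Schwarz over the agents bounds the shared noise by ‖e‖_V times the root of Σ_j ‖S_j‖² in the
dual norms. This sum is at most mN², with N the first summand of √β_T. No union bound over agents is
needed: for each agent, exp of half the squared dual norm, corrected by log det, is a
supermartingale (`setLIntegral_exp_selfNorm_succ_le`); the sum over the agents starts at m, Ville's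
inequality keeps it below 2m/α, and concavity of log gives the bound
(`Run.IsPrivFairX.measureReal_exists_lt_sum_noiseNormSq`). The agent's own later noise is a
difference of two of its noise sums, hence 3√m N in total (`Run.matNorm_thetaHat_sub_le`). So θ_t
lies within 4√m √β_T of θ* in the W-norm (`Run.IsPrivFairX.matNorm_sub_theta_le`).

Regret. A merit policy is Lipschitz in its parameter, with errors averaged under the policy actually
played (`IsMerit.sum_abs_meritPolicy_sub_le`). Hence the regret of a round is controlled by the
expected width ‖x‖ in the W⁻¹-norm of the drawn context. Azuma-Hoeffding passes from expected to
realised widths (`Run.IsPrivFairX.measureReal_sum_meanWidth_le`), which the elliptic potential sums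
(`Run.sum_meanWidth_le`). The exceptional events cost α/2 for the privatizer, α/2 for the reward
noise and δ for the arms. -/

lemma posDef_of_symm_of_pos (hA : Aᵀ = A) (h : ∀ v, v ≠ 0 → 0 < v ⬝ᵥ A *ᵥ v) :
    A.PosDef :=
  Matrix.PosDef.of_dotProduct_mulVec_pos (by simpa [Matrix.IsHermitian] using hA)
    (by simpa using fun v => h v)

lemma _root_.Matrix.PosSemidef.quad_nonneg (hA : A.PosSemidef) (v : Fin d → ℝ) :
    0 ≤ v ⬝ᵥ A *ᵥ v := by
  simpa using hA.dotProduct_mulVec_nonneg v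

lemma _root_.Matrix.PosSemidef.transpose_eq (hA : A.PosSemidef) : Aᵀ = A := by
  simpa [Matrix.IsHermitian] using hA.1

lemma dotProduct_mulVec_comm_of_symm (hA : Aᵀ = A) (v w : Fin d → ℝ) :
    v ⬝ᵥ A *ᵥ w = w ⬝ᵥ A *ᵥ v := by
  rw [Matrix.dotProduct_mulVec, ← Matrix.mulVec_transpose, hA, dotProduct_comm]

lemma matNorm_nonneg (A : Matrix (Fin d) (Fin d) ℝ) (v : Fin d → ℝ) : 0 ≤ matNorm A v :=
  Real.sqrt_nonneg _

lemma sq_matNorm (hA : A.PosSemidef) (v : Fin d → ℝ) : matNorm A v ^ 2 = v ⬝ᵥ A *ᵥ v :=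
  Real.sq_sqrt (hA.quad_nonneg v)

lemma matNorm_le_matNorm (h : ∀ v, v ⬝ᵥ A *ᵥ v ≤ v ⬝ᵥ B *ᵥ v) (v : Fin d → ℝ) :
    matNorm A v ≤ matNorm B v :=
  Real.sqrt_le_sqrt (h v)

lemma _root_.Matrix.PosDef.mulVec_inv_mulVec (hA : A.PosDef) (w : Fin d → ℝ) :
    A *ᵥ (A⁻¹ *ᵥ w) = w := by
  rw [Matrix.mulVec_mulVec, Matrix.mul_nonsing_inv _ hA.det_pos.ne'.isUnit, Matrix.one_mulVec]

lemma _root_.Matrix.PosDef.inv_mulVec_mulVec (hA : A.PosDef) (w : Fin d → ℝ) :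
    A⁻¹ *ᵥ (A *ᵥ w) = w := by
  rw [Matrix.mulVec_mulVec, Matrix.nonsing_inv_mul _ hA.det_pos.ne'.isUnit, Matrix.one_mulVec]

/-- The Cauchy-Schwarz inequality for dual matrix norms. -/
lemma abs_dotProduct_le_matNorm_mul (hA : A.PosDef) (v w : Fin d → ℝ) :
    |v ⬝ᵥ w| ≤ matNorm A v * matNorm A⁻¹ w := by
  -- This quadratic in t is the squared `A`-norm of v - t A⁻¹w; its discriminant is therefore
  -- nonpositive.
  have h : ∀ t : ℝ, 0 ≤ (w ⬝ᵥ A⁻¹ *ᵥ w) * (t * t) + (-2 * (v ⬝ᵥ w)) * t + v ⬝ᵥ A *ᵥ v := by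
    intro t
    have h0 := hA.posSemidef.quad_nonneg (v - t • (A⁻¹ *ᵥ w))
    have h1 : (A⁻¹ *ᵥ w) ⬝ᵥ A *ᵥ v = v ⬝ᵥ w := by
      rw [dotProduct_mulVec_comm_of_symm hA.posSemidef.transpose_eq, hA.mulVec_inv_mulVec]
    rw [Matrix.mulVec_sub, Matrix.mulVec_smul, hA.mulVec_inv_mulVec] at h0
    simp only [sub_dotProduct, dotProduct_sub, smul_dotProduct, dotProduct_smul, smul_eq_mul,
      h1] at h0
    rw [dotProduct_comm (A⁻¹ *ᵥ w) w] at h0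
    linarith
  have hd := discrim_le_zero h
  rw [discrim] at hd
  rw [matNorm, matNorm, ← Real.sqrt_mul (hA.posSemidef.quad_nonneg v)]
  apply Real.abs_le_sqrt
  nlinarith

lemma matNorm_inv_mulVec (hA : A.PosDef) (w : Fin d → ℝ) :
    matNorm A⁻¹ (A *ᵥ w) = matNorm A w := by
  rw [matNorm, matNorm, hA.inv_mulVec_mulVec, dotProduct_comm]

lemma matNorm_add_le (hA : A.PosDef) (v w : Fin d → ℝ) :
    matNorm A (v + w) ≤ matNorm A v + matNorm A w := by
  have h : ∀ u, u ⬝ᵥ A *ᵥ (v + w) ≤ matNorm A u * matNorm A (v + w) := fun u => by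
    have := abs_dotProduct_le_matNorm_mul hA u (A *ᵥ (v + w))
    rw [matNorm_inv_mulVec hA] at this
    exact (le_abs_self _).trans this
  have h2 : matNorm A (v + w) ^ 2 ≤ (matNorm A v + matNorm A w) * matNorm A (v + w) := by
    rw [sq_matNorm hA.posSemidef, add_dotProduct]
    linarith [h v, h w]
  have h3 := matNorm_nonneg A (v + w)
  rcases h3.eq_or_lt with h4 | h4
  · rw [← h4]; exact add_nonneg (matNorm_nonneg _ _) (matNorm_nonneg _ _)
  · nlinarith

lemma matNorm_neg (A : Matrix (Fin d) (Fin d) ℝ) (v : Fin d → ℝ) :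
    matNorm A (-v) = matNorm A v := by
  simp [matNorm, Matrix.mulVec_neg]

lemma matNorm_sub_comm (A : Matrix (Fin d) (Fin d) ℝ) (v w : Fin d → ℝ) :
    matNorm A (v - w) = matNorm A (w - v) := by
  rw [← matNorm_neg, neg_sub]

lemma norm_toLp_sq (v : Fin d → ℝ) : ‖WithLp.toLp 2 v‖ ^ 2 = v ⬝ᵥ v := by
  rw [EuclideanSpace.real_norm_sq_eq]
  simp [dotProduct, sq]

lemma matNorm_smul_one {ρ : ℝ} (hρ : 0 ≤ ρ) (v : Fin d → ℝ) :
    matNorm (ρ • (1 : Matrix (Fin d) (Fin d) ℝ)) v = √ρ * ‖WithLp.toLp 2 v‖ := by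
  rw [matNorm, Matrix.smul_mulVec, Matrix.one_mulVec, dotProduct_smul, smul_eq_mul,
    ← norm_toLp_sq, Real.sqrt_mul hρ, Real.sqrt_sq (norm_nonneg _)]

lemma smul_one_posDef {ρ : ℝ} (hρ : 0 < ρ) : (ρ • (1 : Matrix (Fin d) (Fin d) ℝ)).PosDef :=
  Matrix.PosDef.one.smul hρ

lemma quad_vecMulVec (x v : Fin d → ℝ) : v ⬝ᵥ Matrix.vecMulVec x x *ᵥ v = (v ⬝ᵥ x) ^ 2 := by
  rw [Matrix.vecMulVec_mulVec, dotProduct_smul]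
  simp [dotProduct_comm x v, sq]

lemma posSemidef_vecMulVec_self (x : Fin d → ℝ) : (Matrix.vecMulVec x x).PosSemidef := by
  simpa using Matrix.posSemidef_vecMulVec_self_star x

lemma _root_.Matrix.PosDef.add_vecMulVec (hA : A.PosDef) (x : Fin d → ℝ) :
    (A + Matrix.vecMulVec x x).PosDef :=
  hA.add_posSemidef (posSemidef_vecMulVec_self x)

/-- The matrix determinant lemma. -/
lemma det_add_vecMulVec (hA : A.PosDef) (x : Fin d → ℝ) :
    (A + Matrix.vecMulVec x x).det = A.det * (1 + x ⬝ᵥ A⁻¹ *ᵥ x) := by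
  rw [Matrix.vecMulVec_eq (ι := Unit),
    Matrix.det_add_replicateCol_mul_replicateRow hA.det_pos.ne'.isUnit]
  congr 2
  rw [Matrix.mul_assoc, ← Matrix.replicateCol_mulVec, Matrix.det_unique, Matrix.add_apply,
    Matrix.replicateRow_mul_replicateCol_apply, Matrix.one_apply_eq]

/-- The Sherman-Morrison formula. -/
lemma inv_add_vecMulVec_mulVec (hA : A.PosDef) (x y : Fin d → ℝ) :
    (A + Matrix.vecMulVec x x)⁻¹ *ᵥ y =
      A⁻¹ *ᵥ y - ((x ⬝ᵥ A⁻¹ *ᵥ y) / (1 + x ⬝ᵥ A⁻¹ *ᵥ x)) • (A⁻¹ *ᵥ x) := by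
  have hu : 0 ≤ x ⬝ᵥ A⁻¹ *ᵥ x := hA.inv.posSemidef.quad_nonneg x
  set u := x ⬝ᵥ A⁻¹ *ᵥ x with hudef
  set s := x ⬝ᵥ A⁻¹ *ᵥ y with hs
  have key : (A + Matrix.vecMulVec x x) *ᵥ (A⁻¹ *ᵥ y - (s / (1 + u)) • (A⁻¹ *ᵥ x)) = y := by
    rw [Matrix.mulVec_sub, Matrix.mulVec_smul, Matrix.add_mulVec, Matrix.add_mulVec,
      hA.mulVec_inv_mulVec, hA.mulVec_inv_mulVec, Matrix.vecMulVec_mulVec,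
      Matrix.vecMulVec_mulVec, ← hudef, ← hs]
    ext i
    simp
    field_simp
    ring
  calc (A + Matrix.vecMulVec x x)⁻¹ *ᵥ y
      = (A + Matrix.vecMulVec x x)⁻¹ *ᵥ ((A + Matrix.vecMulVec x x) *ᵥ
          (A⁻¹ *ᵥ y - (s / (1 + u)) • (A⁻¹ *ᵥ x))) := by rw [key]
    _ = _ := (hA.add_vecMulVec x).inv_mulVec_mulVec _

/-- How the dual quadratic form changes in one step of online least squares. -/
lemma quad_inv_add_vecMulVec (hA : A.PosDef) (x y : Fin d → ℝ) (η : ℝ) :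
    (y + η • x) ⬝ᵥ (A + Matrix.vecMulVec x x)⁻¹ *ᵥ (y + η • x) =
      y ⬝ᵥ A⁻¹ *ᵥ y - (x ⬝ᵥ A⁻¹ *ᵥ y) ^ 2 / (1 + x ⬝ᵥ A⁻¹ *ᵥ x)
        + 2 * ((x ⬝ᵥ A⁻¹ *ᵥ y) / (1 + x ⬝ᵥ A⁻¹ *ᵥ x)) * η
        + (x ⬝ᵥ A⁻¹ *ᵥ x) / (1 + x ⬝ᵥ A⁻¹ *ᵥ x) * η ^ 2 := by
  have hu : 0 ≤ x ⬝ᵥ A⁻¹ *ᵥ x := hA.inv.posSemidef.quad_nonneg x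
  have hc : y ⬝ᵥ A⁻¹ *ᵥ x = x ⬝ᵥ A⁻¹ *ᵥ y :=
    dotProduct_mulVec_comm_of_symm hA.inv.posSemidef.transpose_eq _ _
  rw [inv_add_vecMulVec_mulVec hA]
  simp only [Matrix.mulVec_add, Matrix.mulVec_smul, dotProduct_add, add_dotProduct,
    dotProduct_sub, dotProduct_smul, smul_dotProduct, smul_eq_mul, hc]
  set u := x ⬝ᵥ A⁻¹ *ᵥ x
  set s := x ⬝ᵥ A⁻¹ *ᵥ y
  field_simp
  ring

/-- The inequality between the determinant and the trace. -/
lemma log_det_le (hA : A.PosDef) (hd : 0 < d) :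
    Real.log A.det ≤ d * Real.log (A.trace / d) := by
  have hpos := hA.eigenvalues_pos
  have hdet : A.det = ∏ i, hA.1.eigenvalues i := by
    simpa using hA.1.det_eq_prod_eigenvalues
  have htr : A.trace = ∑ i, hA.1.eigenvalues i := by
    simpa using hA.1.trace_eq_sum_eigenvalues
  have hd' : (0 : ℝ) < d := by exact_mod_cast hd
  have h := Real.geom_mean_le_arith_mean (Finset.univ) (fun _ : Fin d => (1 : ℝ))
    hA.1.eigenvalues (by simp) (by simpa using hd) (fun i _ => (hpos i).le)
  simp only [Real.rpow_one, one_mul, Finset.sum_const, Finset.card_univ, Fintype.card_fin,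
    nsmul_eq_mul, mul_one] at h
  rw [← hdet, ← htr] at h
  have h2 := Real.log_le_log (Real.rpow_pos_of_pos hA.det_pos _) h
  rw [Real.log_rpow hA.det_pos, inv_mul_le_iff₀ hd'] at h2
  exact h2

end Quadratic

/-! ### Regularised Gram matrices -/

/-- The Gram matrix of `x 1, …, x k`, regularised by `ρ I`. -/
def regGram {d : ℕ} (ρ : ℝ) (x : ℕ → Fin d → ℝ) (k : ℕ) : Matrix (Fin d) (Fin d) ℝ :=
  ρ • (1 : Matrix (Fin d) (Fin d) ℝ) + ∑ τ ∈ Finset.Icc 1 k, Matrix.vecMulVec (x τ) (x τ)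

section RegGram

variable {d : ℕ} {ρ : ℝ} {x : ℕ → Fin d → ℝ}

lemma regGram_zero : regGram ρ x 0 = ρ • (1 : Matrix (Fin d) (Fin d) ℝ) := by
  simp [regGram]

lemma regGram_succ (k : ℕ) :
    regGram ρ x (k + 1) = regGram ρ x k + Matrix.vecMulVec (x (k + 1)) (x (k + 1)) := by
  rw [regGram, regGram, Finset.sum_Icc_succ_top (by omega), add_assoc]

lemma quad_regGram (k : ℕ) (v : Fin d → ℝ) :
    v ⬝ᵥ regGram ρ x k *ᵥ v = ρ * (v ⬝ᵥ v) + ∑ τ ∈ Finset.Icc 1 k, (v ⬝ᵥ x τ) ^ 2 := by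
  rw [regGram, Matrix.add_mulVec, dotProduct_add, Matrix.smul_mulVec, Matrix.one_mulVec,
    dotProduct_smul, smul_eq_mul, Matrix.sum_mulVec, dotProduct_sum]
  simp only [quad_vecMulVec]

lemma regGram_posDef (hρ : 0 < ρ) (k : ℕ) : (regGram ρ x k).PosDef :=
  (smul_one_posDef hρ).add_posSemidef
    (Matrix.posSemidef_sum _ fun τ _ => posSemidef_vecMulVec_self (x τ))

lemma det_regGram_zero : (regGram ρ x 0).det = ρ ^ d := by
  simp [regGram_zero]

lemma log_det_regGram_succ (hρ : 0 < ρ) (k : ℕ) :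
    Real.log (regGram ρ x (k + 1)).det = Real.log (regGram ρ x k).det
      + Real.log (1 + x (k + 1) ⬝ᵥ (regGram ρ x k)⁻¹ *ᵥ x (k + 1)) := by
  have h := regGram_posDef (x := x) hρ k
  have := h.inv.posSemidef.quad_nonneg (x (k + 1))
  rw [regGram_succ, det_add_vecMulVec h, Real.log_mul h.det_pos.ne' (by positivity)]

lemma trace_regGram_le {k : ℕ} (hx : ∀ τ ∈ Finset.Icc 1 k, x τ ⬝ᵥ x τ ≤ 1) :
    (regGram ρ x k).trace ≤ d * ρ + k := by
  rw [regGram, Matrix.trace_add, Matrix.trace_smul, Matrix.trace_one, Matrix.trace_sum]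
  simp only [Matrix.trace_vecMulVec, Fintype.card_fin, smul_eq_mul]
  have := Finset.sum_le_sum hx
  simp at this
  linarith [mul_comm ρ (d : ℝ)]

/-- The growth of the determinant of a regularised Gram matrix of vectors in the unit ball. -/
lemma log_det_regGram_sub_le (hρ : 0 < ρ) (hd : 0 < d) {k : ℕ}
    (hx : ∀ τ ∈ Finset.Icc 1 k, x τ ⬝ᵥ x τ ≤ 1) :
    Real.log (regGram ρ x k).det - d * Real.log ρ ≤ d * Real.log (1 + k / (d * ρ)) := by
  have hA := regGram_posDef (x := x) hρ k
  have hd' : (0 : ℝ) < d := by exact_mod_cast hd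
  have : Nonempty (Fin d) := ⟨⟨0, hd⟩⟩
  have h1 := log_det_le hA hd
  have htr : (regGram ρ x k).trace / d ≤ ρ * (1 + k / (d * ρ)) := by
    rw [div_le_iff₀ hd']
    have := trace_regGram_le (ρ := ρ) hx
    have e : ρ * (1 + k / (d * ρ)) * d = d * ρ + k := by field_simp
    linarith
  have h2 := Real.log_le_log (div_pos hA.trace_pos hd') htr
  rw [Real.log_mul hρ.ne' (by positivity)] at h2
  nlinarith

/-- The elliptic potential lemma. -/
lemma sum_log_one_add_le (hρ : 0 < ρ) (hd : 0 < d) {T : ℕ}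
    (hx : ∀ τ ∈ Finset.Icc 1 T, x τ ⬝ᵥ x τ ≤ 1) :
    ∑ t ∈ Finset.Icc 1 T, Real.log (1 + x t ⬝ᵥ (regGram ρ x (t - 1))⁻¹ *ᵥ x t)
      ≤ d * Real.log (1 + T / (d * ρ)) := by
  -- By the determinant lemma each summand is an increment of log det, so the sum telescopes.
  have h : ∀ k : ℕ, ∑ t ∈ Finset.Icc 1 k, Real.log (1 + x t ⬝ᵥ (regGram ρ x (t - 1))⁻¹ *ᵥ x t)
      = Real.log (regGram ρ x k).det - d * Real.log ρ := by
    intro k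
    induction k with
    | zero => simp [det_regGram_zero]
    | succ k ih =>
      rw [Finset.sum_Icc_succ_top (by omega), ih, log_det_regGram_succ hρ, Nat.add_sub_cancel]
      ring
  rw [h]
  exact log_det_regGram_sub_le hρ hd hx

/-- With A the regularised matrix and w = A⁻¹v, A ≽ ρ I gives ρ‖w‖² ≤ v·w, while Cauchy-Schwarz
gives (v·w)² ≤ ‖w‖². -/
lemma quad_inv_regGram_le (hρ : 0 < ρ) (k : ℕ) {v : Fin d → ℝ} (hv : v ⬝ᵥ v ≤ 1) :
    v ⬝ᵥ (regGram ρ x k)⁻¹ *ᵥ v ≤ 1 / ρ := by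
  have hA := regGram_posDef (x := x) hρ k
  set w := (regGram ρ x k)⁻¹ *ᵥ v with hw
  have h1 : v ⬝ᵥ w = w ⬝ᵥ regGram ρ x k *ᵥ w := by
    rw [hw, hA.mulVec_inv_mulVec, dotProduct_comm]
  have h2 : ρ * (w ⬝ᵥ w) ≤ v ⬝ᵥ w := by
    rw [h1, quad_regGram]
    have : 0 ≤ ∑ τ ∈ Finset.Icc 1 k, (w ⬝ᵥ x τ) ^ 2 := Finset.sum_nonneg fun _ _ => sq_nonneg _
    linarith
  have h3 : (v ⬝ᵥ w) ^ 2 ≤ (v ⬝ᵥ v) * (w ⬝ᵥ w) := by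
    simp only [dotProduct, ← sq]
    exact Finset.sum_mul_sq_le_sq_mul_sq _ _ _
  have h4 : 0 ≤ w ⬝ᵥ w := by
    rw [← norm_toLp_sq]; positivity
  have h5 : 0 ≤ v ⬝ᵥ w := by nlinarith
  rw [le_div_iff₀ hρ]
  by_contra! hc
  have h6 : (v ⬝ᵥ w) ^ 2 ≤ w ⬝ᵥ w := h3.trans (by nlinarith)
  have h7 : 0 < v ⬝ᵥ w := pos_of_mul_pos_left (one_pos.trans hc) hρ.le
  nlinarith [mul_pos h7 (sub_pos.2 hc), mul_le_mul_of_nonneg_left h6 hρ.le]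

/-- The sum of the norms in the elliptic potential lemma. -/
lemma sum_matNorm_inv_regGram_le (hρ : 0 < ρ) (hd : 0 < d) {r : ℝ} (hr : 0 < r) (hrρ : r ≤ ρ)
    {T : ℕ} (hx : ∀ τ ∈ Finset.Icc 1 T, x τ ⬝ᵥ x τ ≤ 1) :
    ∑ t ∈ Finset.Icc 1 T, matNorm (regGram ρ x (t - 1))⁻¹ (x t)
      ≤ √((1 + 1 / r) * (T * d * Real.log (1 + T / (d * ρ)))) := by
  apply Real.le_sqrt_of_sq_le
  have h1 := sq_sum_le_card_mul_sum_sq (s := Finset.Icc 1 T)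
    (f := fun t => matNorm (regGram ρ x (t - 1))⁻¹ (x t))
  simp only [Nat.card_Icc, Nat.add_sub_cancel] at h1
  have h2 : ∑ t ∈ Finset.Icc 1 T, matNorm (regGram ρ x (t - 1))⁻¹ (x t) ^ 2 ≤
      (1 + 1 / r) * (d * Real.log (1 + T / (d * ρ))) := by
    refine le_trans ?_ (mul_le_mul_of_nonneg_left (sum_log_one_add_le hρ hd hx) (by positivity))
    rw [Finset.mul_sum]
    refine Finset.sum_le_sum fun t ht => ?_
    have hA := (regGram_posDef (x := x) hρ (t - 1)).inv.posSemidef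
    rw [sq_matNorm hA]
    have hu0 := hA.quad_nonneg (x t)
    -- The bound r ≤ ρ enters here: u ≤ 1/r makes 1 + u at most 1 + 1/r, which lets u be compared
    -- with log(1 + u).
    have hu1 := (quad_inv_regGram_le (x := x) hρ (t - 1) (hx t ht)).trans
      (one_div_le_one_div_of_le hr hrρ)
    set u := x t ⬝ᵥ (regGram ρ x (t - 1))⁻¹ *ᵥ x t
    have h3 : u / (1 + u) ≤ Real.log (1 + u) := by
      have := Real.one_sub_inv_le_log_of_pos (show 0 < 1 + u by positivity)
      convert this using 1
      field_simp
      ring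
    calc u = (1 + u) * (u / (1 + u)) := by field_simp
      _ ≤ (1 + 1 / r) * Real.log (1 + u) := by gcongr
  calc _ ≤ _ := h1
    _ ≤ T * ((1 + 1 / r) * (d * Real.log (1 + T / (d * ρ)))) := by gcongr
    _ = _ := by ring

end RegGram

/-! ### Sub-Gaussian variables and maximal inequalities -/

section Probability

open scoped ENNReal

variable {Ω : Type*} {𝒢 mΩ : MeasurableSpace Ω} {P : Measure Ω} [IsProbabilityMeasure P]

/-- Gaussian linearisation: the exponential of a square is an average of exponentials of linear
functions, to which the sub-Gaussian bound applies. -/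
lemma exp_quadratic_eq_lintegral_gaussian (a y : ℝ) {b : ℝ} (hb : 0 ≤ b) :
    ENNReal.ofReal (Real.exp (a * y + b * y ^ 2 / 2))
      = ∫⁻ g, ENNReal.ofReal (Real.exp ((a + √b * g) * y)) ∂(gaussianReal 0 1) := by
  have hint : Integrable (fun g : ℝ => Real.exp ((a + √b * g) * y)) (gaussianReal 0 1) := by
    have := (integrable_exp_mul_gaussianReal (μ := 0) (v := 1) (√b * y)).const_mul
      (Real.exp (a * y))
    refine this.congr (ae_of_all _ fun g => ?_)
    simp only [← Real.exp_add]
    ring_nf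
  rw [← ofReal_integral_eq_lintegral_ofReal hint (ae_of_all _ fun _ => (Real.exp_pos _).le)]
  congr 1
  have h := mgf_gaussianReal (p := gaussianReal 0 1) (X := id) (μ := 0) (v := 1)
    (by simp) (√b * y)
  have e : ∀ g : ℝ, Real.exp ((a + √b * g) * y) = Real.exp (a * y) * Real.exp (√b * y * g) := by
    intro g; rw [← Real.exp_add]; ring_nf
  simp only [e]
  rw [integral_const_mul]
  simp only [mgf, id] at h
  rw [h, ← Real.exp_add, mul_pow, Real.sq_sqrt hb]
  congr 1
  simp

/-- Completing the square turns the integrand times the standard density into a constant times the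
density of a Gaussian of variance 1/(1 - b); hence the condition b < 1. -/
lemma lintegral_exp_sq_gaussian (a : ℝ) {b : ℝ} (hb : 0 ≤ b) (hb1 : b < 1) :
    ∫⁻ g, ENNReal.ofReal (Real.exp ((a + √b * g) ^ 2 / 2)) ∂(gaussianReal 0 1)
      = ENNReal.ofReal ((√(1 - b))⁻¹ * Real.exp (a ^ 2 / (2 * (1 - b)))) := by
  have hc : 0 < 1 - b := by linarith
  have hv : Real.toNNReal (1 - b)⁻¹ ≠ 0 := (Real.toNNReal_pos.2 (inv_pos.2 hc)).ne'
  rw [gaussianReal_of_var_ne_zero _ one_ne_zero,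
    lintegral_withDensity_eq_lintegral_mul _ (measurable_gaussianPDF _ _) (by fun_prop)]
  have e : ∀ g : ℝ, (gaussianPDF 0 1 * fun g => ENNReal.ofReal (Real.exp ((a + √b * g) ^ 2 / 2))) g
      = ENNReal.ofReal ((√(1 - b))⁻¹ * Real.exp (a ^ 2 / (2 * (1 - b))))
        * gaussianPDF (a * √b / (1 - b)) (Real.toNNReal (1 - b)⁻¹) g := by
    intro g
    simp only [Pi.mul_apply, gaussianPDF]
    rw [← ENNReal.ofReal_mul (gaussianPDFReal_nonneg _ _ _), ← ENNReal.ofReal_mul (by positivity)]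
    congr 1
    simp only [gaussianPDFReal, NNReal.coe_one,
      Real.coe_toNNReal _ (inv_pos.2 hc).le]
    have h1 : (√(2 * Real.pi * (1 - b)⁻¹))⁻¹ = √(1 - b) * (√(2 * Real.pi))⁻¹ := by
      rw [Real.sqrt_mul (by positivity), Real.sqrt_inv, mul_inv, inv_inv, mul_comm]
    rw [h1, mul_one]
    have h2 : (√(1 - b))⁻¹ * Real.exp (a ^ 2 / (2 * (1 - b))) *
        (√(1 - b) * (√(2 * Real.pi))⁻¹ *
          Real.exp (-(g - a * √b / (1 - b)) ^ 2 / (2 * (1 - b)⁻¹)))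
        = (√(2 * Real.pi))⁻¹ * (Real.exp (a ^ 2 / (2 * (1 - b))) *
          Real.exp (-(g - a * √b / (1 - b)) ^ 2 / (2 * (1 - b)⁻¹))) := by
      have := Real.sqrt_pos.2 hc
      field_simp
    rw [h2, mul_assoc, ← Real.exp_add, ← Real.exp_add]
    congr 2
    have hs := Real.sq_sqrt hb
    field_simp
    ring_nf
    rw [hs]
    ring
  rw [lintegral_congr e, lintegral_const_mul _ (measurable_gaussianPDF _ _),
    lintegral_gaussianPDF_eq_one _ hv, mul_one]

/-- The exponential moments of a quadratic function of a sub-Gaussian variable are at most those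
of the standard Gaussian. -/
lemma lintegral_exp_quadratic_le {X : Ω → ℝ} (hXm : Measurable X) (hX : HasSubgaussianMGF X 1 P)
    (a : ℝ) {b : ℝ} (hb : 0 ≤ b) (hb1 : b < 1) :
    ∫⁻ ω, ENNReal.ofReal (Real.exp (a * X ω + b * X ω ^ 2 / 2)) ∂P
      ≤ ENNReal.ofReal ((√(1 - b))⁻¹ * Real.exp (a ^ 2 / (2 * (1 - b)))) := by
  calc ∫⁻ ω, ENNReal.ofReal (Real.exp (a * X ω + b * X ω ^ 2 / 2)) ∂P
      = ∫⁻ ω, ∫⁻ g, ENNReal.ofReal (Real.exp ((a + √b * g) * X ω)) ∂(gaussianReal 0 1) ∂P :=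
        lintegral_congr fun ω => exp_quadratic_eq_lintegral_gaussian a (X ω) hb
    _ = ∫⁻ g, ∫⁻ ω, ENNReal.ofReal (Real.exp ((a + √b * g) * X ω)) ∂P ∂(gaussianReal 0 1) := by
        apply lintegral_lintegral_swap
        apply Measurable.aemeasurable
        fun_prop
    _ ≤ ∫⁻ g, ENNReal.ofReal (Real.exp ((a + √b * g) ^ 2 / 2)) ∂(gaussianReal 0 1) := by
        refine lintegral_mono fun g => ?_
        rw [← ofReal_integral_eq_lintegral_ofReal (hX.integrable_exp_mul _)
          (ae_of_all _ fun _ => (Real.exp_pos _).le)]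
        have := hX.mgf_le (a + √b * g)
        rw [mgf, NNReal.coe_one, one_mul] at this
        exact ENNReal.ofReal_le_ofReal this
    _ = _ := lintegral_exp_sq_gaussian a hb hb1

/-- `lintegral_exp_quadratic_le`, conditionally on a σ-algebra of which `X` is independent. -/
lemma lintegral_mul_exp_quadratic_le (h𝒢 : 𝒢 ≤ mΩ) {X : Ω → ℝ}
    (hXm : Measurable X) (hX : HasSubgaussianMGF X 1 P)
    (hind : Indep (MeasurableSpace.comap X inferInstance) 𝒢 P)
    {M : Ω → ℝ≥0∞} (hM : Measurable[𝒢] M) {a b : Ω → ℝ} (ha : Measurable[𝒢] a)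
    (hb : Measurable[𝒢] b) (hb0 : ∀ ω, 0 ≤ b ω) (hb1 : ∀ ω, b ω < 1) :
    ∫⁻ ω, M ω * ENNReal.ofReal (Real.exp (a ω * X ω + b ω * X ω ^ 2 / 2)) ∂P
      ≤ ∫⁻ ω, M ω * ENNReal.ofReal
          ((√(1 - b ω))⁻¹ * Real.exp (a ω ^ 2 / (2 * (1 - b ω)))) ∂P := by
  -- The weight and the coefficients form one variable independent of `X`, so Fubini on the product
  -- law lets them be treated as constants.
  have hY𝒢 : Measurable[𝒢] fun ω => (M ω, a ω, b ω) := hM.prodMk (ha.prodMk hb)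
  set Y : Ω → ℝ≥0∞ × ℝ × ℝ := fun ω => (M ω, a ω, b ω) with hY
  have hYm : Measurable Y := hY𝒢.mono h𝒢 le_rfl
  have hindF : IndepFun Y X P := by
    rw [IndepFun_iff_Indep]
    exact (indep_of_indep_of_le_right hind hY𝒢.comap_le).symm
  have hprod := (indepFun_iff_map_prod_eq_prod_map_map hYm.aemeasurable hXm.aemeasurable).1 hindF
  have hF : Measurable fun p : (ℝ≥0∞ × ℝ × ℝ) × ℝ =>
      p.1.1 * ENNReal.ofReal (Real.exp (p.1.2.1 * p.2 + p.1.2.2 * p.2 ^ 2 / 2)) := by fun_prop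
  have h1 : ∫⁻ ω, M ω * ENNReal.ofReal (Real.exp (a ω * X ω + b ω * X ω ^ 2 / 2)) ∂P
      = ∫⁻ p, p.1.1 * ENNReal.ofReal (Real.exp (p.1.2.1 * p.2 + p.1.2.2 * p.2 ^ 2 / 2))
          ∂(P.map fun ω => (Y ω, X ω)) := by
    rw [lintegral_map hF (hYm.prodMk hXm)]
  have : IsProbabilityMeasure (P.map Y) := Measure.isProbabilityMeasure_map hYm.aemeasurable
  have : IsProbabilityMeasure (P.map X) := Measure.isProbabilityMeasure_map hXm.aemeasurable
  rw [h1, hprod, lintegral_prod _ hF.aemeasurable, lintegral_map hF.lintegral_prod_right' hYm]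
  refine lintegral_mono fun ω => ?_
  rw [lintegral_map (by fun_prop) hXm]
  simp only [hY]
  rw [lintegral_const_mul _ (by fun_prop)]
  gcongr
  exact lintegral_exp_quadratic_le hXm hX (a ω) (hb0 ω) (hb1 ω)

/-- Ville's maximal inequality over a finite horizon. -/
lemma mul_measure_exists_le {P : Measure Ω} {𝒢 : ℕ → MeasurableSpace Ω} (hmono : Monotone 𝒢)
    (hle : ∀ k, 𝒢 k ≤ mΩ) {T : ℕ} {M : ℕ → Ω → ℝ≥0∞}
    (hM : ∀ k ≤ T, Measurable[𝒢 k] (M k))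
    (hstep : ∀ k < T, ∀ A, MeasurableSet[𝒢 k] A →
      ∫⁻ ω in A, M (k + 1) ω ∂P ≤ ∫⁻ ω in A, M k ω ∂P) (K : ℝ≥0∞) :
    K * P {ω | ∃ k ≤ T, K ≤ M k ω} ≤ ∫⁻ ω, M 0 ω ∂P := by
  have hE : ∀ k ≤ T, MeasurableSet[𝒢 k] {ω | ∃ l ≤ k, K ≤ M l ω} := by
    intro k hk
    have : {ω | ∃ l ≤ k, K ≤ M l ω} = ⋃ l ∈ Finset.range (k + 1), {ω | K ≤ M l ω} := by
      ext ω; simp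
    rw [this]
    refine Finset.measurableSet_biUnion _ fun l hl => ?_
    have hl' : l ≤ k := by simpa [Nat.lt_succ_iff] using hl
    exact hmono hl' _ (hM l (hl'.trans hk) measurableSet_Ici)
  -- Stopping at the first crossing, written without stopping times: the mass where the level is not
  -- yet reached, plus `K` times the probability of having reached it, never exceeds the initial
  -- mass.
  have hind : ∀ k ≤ T, ∫⁻ ω in {ω | ∃ l ≤ k, K ≤ M l ω}ᶜ, M k ω ∂P
      + K * P {ω | ∃ l ≤ k, K ≤ M l ω} ≤ ∫⁻ ω, M 0 ω ∂P := by
    intro k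
    induction k with
    | zero =>
      intro hk
      have hE0 := hle _ _ (hE 0 hk)
      refine le_of_le_of_eq ?_ (lintegral_add_compl (M 0) hE0)
      rw [add_comm]
      refine add_le_add ?_ le_rfl
      rw [← setLIntegral_const]
      refine setLIntegral_mono_ae' hE0 (ae_of_all _ fun ω hω => ?_)
      simpa using hω
    | succ k ih =>
      intro hk
      refine le_trans ?_ (ih (by omega))
      have hEk := hE k (by omega)
      have hEk' := hle _ _ hEk
      have hEs := hle _ _ (hE (k + 1) hk)
      refine le_trans ?_ (add_le_add_left (hstep k (by omega) _ hEk.compl) _)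
      set A := {ω | ∃ l ≤ k, K ≤ M l ω}
      set B := {ω | ∃ l ≤ k + 1, K ≤ M l ω}
      have hAB : A ⊆ B := fun ω ⟨l, hl, h⟩ => ⟨l, by omega, h⟩
      have hsplit : ∫⁻ ω in Aᶜ, M (k + 1) ω ∂P
          = ∫⁻ ω in Bᶜ, M (k + 1) ω ∂P + ∫⁻ ω in B \ A, M (k + 1) ω ∂P := by
        rw [← lintegral_union (hEs.diff hEk')]
        · congr 2
          ext ω
          simp only [Set.mem_compl_iff, Set.mem_union, Set.mem_sdiff]
          constructor
          · intro h; by_cases hb : ω ∈ B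
            · exact Or.inr ⟨hb, h⟩
            · exact Or.inl hb
          · rintro (h | h)
            · exact fun h' => h (hAB h')
            · exact h.2
        · exact Set.disjoint_left.2 fun ω h h' => h h'.1
      have hPB : P B = P (B \ A) + P A := by
        rw [← measure_sdiff_add_inter B hEk', Set.inter_eq_right.2 hAB]
      rw [hsplit, hPB, mul_add, add_assoc]
      gcongr
      rw [← setLIntegral_const]
      refine setLIntegral_mono_ae' (hEs.diff hEk') (ae_of_all _ fun ω hω => ?_)
      obtain ⟨⟨l, hl, h⟩, hA⟩ := hω
      rcases Nat.lt_or_ge l (k + 1) with h' | h'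
      · exact absurd ⟨l, by omega, h⟩ hA
      · rwa [show k + 1 = l by omega]
  refine le_trans ?_ (hind T le_rfl)
  exact le_add_self

/-- Take inverses in exp y ≥ 1 + y + y²/2 and use (1 + y + y²/2)(1 - y + y²/2) = 1 + y⁴/4. -/
lemma exp_neg_le {y : ℝ} (hy : 0 ≤ y) : Real.exp (-y) ≤ 1 - y + y ^ 2 / 2 := by
  have h := Real.quadratic_le_exp_of_nonneg hy
  rw [Real.exp_neg, inv_le_iff_one_le_mul₀ (Real.exp_pos _)]
  have h2 : 0 ≤ 1 - y + y ^ 2 / 2 := by nlinarith [sq_nonneg (y - 1)]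
  nlinarith [mul_le_mul_of_nonneg_left h h2, sq_nonneg (y ^ 2)]

/-- A one-sided Azuma-Hoeffding inequality for nonnegative bounded variables `X t` with
predictable means `q t`. -/
lemma measureReal_sum_add_le_sum_le {ℱ : Filtration ℕ mΩ} {T : ℕ} (hT : 0 < T)
    {X q : ℕ → Ω → ℝ} {K : ℝ} (hK : 0 < K)
    (hX : ∀ t ∈ Finset.Icc 1 T, Measurable[ℱ (t + 1)] (X t))
    (hq : ∀ t ∈ Finset.Icc 1 T, Measurable[ℱ t] (q t))
    (hXm : ∀ t ∈ Finset.Icc 1 T, ∀ ω, X t ω ∈ Set.Icc 0 K)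
    (hqm : ∀ t ∈ Finset.Icc 1 T, ∀ ω, q t ω ∈ Set.Icc 0 K)
    (hmean : ∀ t ∈ Finset.Icc 1 T, ∀ Y : Ω → ℝ, Measurable[ℱ t] Y → (∃ B, ∀ ω, |Y ω| ≤ B) →
      ∫ ω, Y ω * X t ω ∂P = ∫ ω, Y ω * q t ω ∂P)
    {δ : ℝ} (hδ : 0 < δ) (hδ1 : δ < 1) :
    P.real {ω | ∑ t ∈ Finset.Icc 1 T, X t ω + K * √(2 * T * Real.log (1 / δ))
      ≤ ∑ t ∈ Finset.Icc 1 T, q t ω} ≤ δ := by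
  have hT' : (0 : ℝ) < T := by exact_mod_cast hT
  have hlog : 0 < Real.log (1 / δ) := Real.log_pos (by rw [lt_div_iff₀ hδ]; linarith)
  set ε := K * √(2 * T * Real.log (1 / δ)) with hε
  have hε0 : 0 < ε := by positivity
  -- The minimiser of the Chernoff exponent T l²K²/2 - lε, whose minimum is log δ for the chosen ε.
  set l := ε / (K ^ 2 * T) with hl
  have hl0 : 0 < l := by positivity
  set F : ℕ → Ω → ℝ := fun k ω => Real.exp (l * ∑ t ∈ Finset.Icc 1 k, (q t ω - X t ω)) with hF
  have hFm : ∀ k ≤ T, Measurable[ℱ (k + 1)] (F k) := by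
    intro k hk
    refine Real.measurable_exp.comp (Measurable.const_mul ?_ l)
    refine Finset.measurable_sum _ fun t ht => ?_
    have ht' : 1 ≤ t ∧ t ≤ k := Finset.mem_Icc.1 ht
    have htT : t ∈ Finset.Icc 1 T := Finset.mem_Icc.2 ⟨ht'.1, ht'.2.trans hk⟩
    exact ((hq t htT).mono (ℱ.mono (by omega)) le_rfl).sub
      ((hX t htT).mono (ℱ.mono (by omega)) le_rfl)
  have hFb : ∀ k ≤ T, ∀ ω, F k ω ≤ Real.exp (l * (k * K)) := by
    intro k hk ω
    simp only [hF]
    gcongr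
    calc ∑ t ∈ Finset.Icc 1 k, (q t ω - X t ω) ≤ ∑ t ∈ Finset.Icc 1 k, K := by
          refine Finset.sum_le_sum fun t ht => ?_
          have ht' : 1 ≤ t ∧ t ≤ k := Finset.mem_Icc.1 ht
          have htT : t ∈ Finset.Icc 1 T := Finset.mem_Icc.2 ⟨ht'.1, ht'.2.trans hk⟩
          linarith [(hXm t htT ω).1, (hqm t htT ω).2]
      _ = k * K := by simp
  have hF0 : ∀ k ω, 0 < F k ω := fun k ω => Real.exp_pos _
  have hint : ∀ {Y : Ω → ℝ}, Measurable Y → (∃ B, ∀ ω, |Y ω| ≤ B) → Integrable Y P := by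
    rintro Y hY ⟨B, hB⟩
    exact Integrable.of_bound hY.aestronglyMeasurable B (ae_of_all _ hB)
  have hFint : ∀ k ≤ T, Integrable (F k) P := fun k hk =>
    hint ((hFm k hk).mono (ℱ.le _) le_rfl)
      ⟨_, fun ω => by rw [abs_of_pos (hF0 k ω)]; exact hFb k hk ω⟩
  have hstep : ∀ k < T, ∫ ω, F (k + 1) ω ∂P
      ≤ Real.exp (l ^ 2 * K ^ 2 / 2) * ∫ ω, F k ω ∂P := by
    intro k hk
    have htT : k + 1 ∈ Finset.Icc 1 T := Finset.mem_Icc.2 ⟨by omega, hk⟩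
    -- All factors already known before `X (k + 1)`. Once exp(-lX) is bounded by an affine function
    -- of X, `hmean` with this test function replaces X by q.
    set Y : Ω → ℝ := fun ω => F k ω * Real.exp (l * q (k + 1) ω) with hY
    have hYm : Measurable[ℱ (k + 1)] Y :=
      (hFm k hk.le).mul (Real.measurable_exp.comp ((hq _ htT).const_mul l))
    have hYm' : Measurable Y := hYm.mono (ℱ.le _) le_rfl
    have hY0 : ∀ ω, 0 < Y ω := fun ω => mul_pos (hF0 k ω) (Real.exp_pos _)
    have hYb : ∀ ω, |Y ω| ≤ Real.exp (l * (k * K)) * Real.exp (l * K) := by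
      intro ω
      rw [abs_of_pos (hY0 ω)]
      exact mul_le_mul (hFb k hk.le ω)
        (Real.exp_le_exp.2 (mul_le_mul_of_nonneg_left (hqm _ htT ω).2 hl0.le))
        (Real.exp_pos _).le (Real.exp_pos _).le
    have hXm' : Measurable (X (k + 1)) := (hX _ htT).mono (ℱ.le _) le_rfl
    have hqm' : Measurable (q (k + 1)) := (hq _ htT).mono (ℱ.le _) le_rfl
    have hYX : ∀ {Z : Ω → ℝ}, Measurable Z → (∀ ω, Z ω ∈ Set.Icc 0 K) →
        Integrable (fun ω => Y ω * Z ω) P := by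
      intro Z hZ hZK
      refine hint (hYm'.mul hZ) ⟨Real.exp (l * (k * K)) * Real.exp (l * K) * K, fun ω => ?_⟩
      rw [abs_mul, abs_of_nonneg (hZK ω).1]
      exact mul_le_mul (hYb ω) (hZK ω).2 (hZK ω).1 (by positivity)
    have hYi : Integrable Y P := hint hYm' ⟨_, hYb⟩
    have hFs : ∀ ω, F (k + 1) ω = Y ω * Real.exp (-(l * X (k + 1) ω)) := by
      intro ω
      simp only [hY, hF, ← Real.exp_add]
      rw [Finset.sum_Icc_succ_top (by omega)]
      ring_nf
    have hlin : ∀ {Z : Ω → ℝ}, Integrable (fun ω => Y ω * Z ω) P →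
        ∫ ω, Y ω * (1 - l * Z ω + l ^ 2 * K ^ 2 / 2) ∂P
          = (1 + l ^ 2 * K ^ 2 / 2) * ∫ ω, Y ω ∂P - l * ∫ ω, Y ω * Z ω ∂P := by
      intro Z hZ
      rw [← integral_const_mul, ← integral_const_mul, ← integral_sub (hYi.const_mul _)
        (hZ.const_mul _)]
      congr 1; ext ω; ring
    have hlin_int : ∀ {Z : Ω → ℝ}, Integrable (fun ω => Y ω * Z ω) P →
        Integrable (fun ω => Y ω * (1 - l * Z ω + l ^ 2 * K ^ 2 / 2)) P := by
      intro Z hZ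
      refine ((hYi.const_mul (1 + l ^ 2 * K ^ 2 / 2)).sub (hZ.const_mul l)).congr
        (ae_of_all _ fun ω => ?_)
      simp only [Pi.sub_apply]
      ring
    calc ∫ ω, F (k + 1) ω ∂P
        ≤ ∫ ω, Y ω * (1 - l * X (k + 1) ω + l ^ 2 * K ^ 2 / 2) ∂P := by
          refine integral_mono (hFint _ hk) (hlin_int (hYX hXm' (hXm _ htT))) fun ω => ?_
          simp only
          rw [hFs ω]
          refine mul_le_mul_of_nonneg_left ?_ (hY0 ω).le
          obtain ⟨h0, h1⟩ := hXm _ htT ω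
          refine (exp_neg_le (mul_nonneg hl0.le h0)).trans ?_
          have : (l * X (k + 1) ω) ^ 2 ≤ l ^ 2 * K ^ 2 := by
            rw [mul_pow]; gcongr
          linarith
      _ = ∫ ω, Y ω * (1 - l * q (k + 1) ω + l ^ 2 * K ^ 2 / 2) ∂P := by
          rw [hlin (hYX hXm' (hXm _ htT)), hlin (hYX hqm' (hqm _ htT)),
            hmean _ htT Y hYm ⟨_, hYb⟩]
      _ ≤ ∫ ω, Real.exp (l ^ 2 * K ^ 2 / 2) * F k ω ∂P := by
          refine integral_mono (hlin_int (hYX hqm' (hqm _ htT)))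
            ((hFint k hk.le).const_mul _) fun ω => ?_
          simp only
          calc Y ω * (1 - l * q (k + 1) ω + l ^ 2 * K ^ 2 / 2)
              ≤ Y ω * Real.exp (-(l * q (k + 1) ω) + l ^ 2 * K ^ 2 / 2) := by
                refine mul_le_mul_of_nonneg_left ?_ (hY0 ω).le
                have := Real.add_one_le_exp (-(l * q (k + 1) ω) + l ^ 2 * K ^ 2 / 2)
                linarith
            _ = Real.exp (l ^ 2 * K ^ 2 / 2) * F k ω := by
                simp only [hY, hF, ← Real.exp_add]
                ring_nf
      _ = _ := integral_const_mul _ _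
  have hE : ∀ k ≤ T, ∫ ω, F k ω ∂P ≤ Real.exp (k * (l ^ 2 * K ^ 2 / 2)) := by
    intro k
    induction k with
    | zero => intro _; simp [hF]
    | succ k ih =>
      intro hk
      refine (hstep k hk).trans ?_
      refine (mul_le_mul_of_nonneg_left (ih (by omega)) (Real.exp_pos _).le).trans ?_
      rw [← Real.exp_add]
      apply le_of_eq
      push_cast
      ring_nf
  have hmarkov := mul_meas_ge_le_integral_of_nonneg (ae_of_all P fun ω => (hF0 T ω).le)
    (hFint T le_rfl) (Real.exp (l * ε))
  have hset : {ω | ∑ t ∈ Finset.Icc 1 T, X t ω + ε ≤ ∑ t ∈ Finset.Icc 1 T, q t ω}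
      ⊆ {ω | Real.exp (l * ε) ≤ F T ω} := by
    intro ω hω
    simp only [Set.mem_ofPred_eq, hF, Finset.sum_sub_distrib] at hω ⊢
    gcongr
    linarith
  refine (measureReal_mono hset).trans ?_
  have h3 : Real.exp (l * ε) * P.real {ω | Real.exp (l * ε) ≤ F T ω}
      ≤ Real.exp (l * ε) * δ := by
    refine (hmarkov.trans (hE T le_rfl)).trans ?_
    refine le_of_le_of_eq (Real.exp_le_exp.2 ?_)
      (show Real.exp (l * ε + Real.log δ) = _ by rw [Real.exp_add, Real.exp_log hδ])
    have hlogδ : Real.log (1 / δ) = - Real.log δ := by rw [one_div, Real.log_inv]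
    have hε2 : ε ^ 2 = K ^ 2 * (2 * T * -Real.log δ) := by
      rw [hε, mul_pow, Real.sq_sqrt (by positivity), hlogδ]
    have e1 : (T : ℝ) * (l ^ 2 * K ^ 2 / 2) = -Real.log δ := by
      rw [hl, div_pow, hε2]; field_simp
    have e2 : l * ε = 2 * -Real.log δ := by
      rw [hl, div_mul_eq_mul_div, ← sq, hε2]; field_simp
    rw [e1, e2]
    linarith
  exact le_of_mul_le_mul_left h3 (Real.exp_pos _)

end Probability

/-! ### Self-normalised sums -/

/-! ### Measurability of determinants, inverses and quadratic forms of random matrices -/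

section Measurability

variable {Ω : Type*} {mΩ : MeasurableSpace Ω} {d : ℕ}

lemma measurable_det {A : Ω → Matrix (Fin d) (Fin d) ℝ}
    (hA : ∀ i j, Measurable fun ω => A ω i j) : Measurable fun ω => (A ω).det := by
  simp only [Matrix.det_apply]
  exact Finset.measurable_sum _ fun σ _ =>
    (Finset.measurable_prod _ fun i _ => hA _ _).const_smul _

lemma measurable_inv_apply {A : Ω → Matrix (Fin d) (Fin d) ℝ}
    (hA : ∀ i j, Measurable fun ω => A ω i j) (i j : Fin d) :
    Measurable fun ω => (A ω)⁻¹ i j := by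
  simp only [Matrix.inv_def, Matrix.smul_apply, Ring.inverse_eq_inv', smul_eq_mul,
    Matrix.adjugate_apply]
  refine (measurable_det hA).inv.mul (measurable_det fun k l => ?_)
  simp only [Matrix.updateRow_apply]
  split_ifs
  · exact measurable_const
  · exact hA k l

lemma measurable_quad {A : Ω → Matrix (Fin d) (Fin d) ℝ} {v w : Ω → Fin d → ℝ}
    (hA : ∀ i j, Measurable fun ω => A ω i j) (hv : Measurable v) (hw : Measurable w) :
    Measurable fun ω => v ω ⬝ᵥ A ω *ᵥ w ω := by
  simp only [Matrix.mulVec, dotProduct]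
  exact Finset.measurable_sum _ fun i _ => ((measurable_pi_apply i).comp hv).mul
    (Finset.measurable_sum _ fun j _ => (hA i j).mul ((measurable_pi_apply j).comp hw))

lemma measurable_quad_inv {A : Ω → Matrix (Fin d) (Fin d) ℝ} {v w : Ω → Fin d → ℝ}
    (hA : ∀ i j, Measurable fun ω => A ω i j) (hv : Measurable v) (hw : Measurable w) :
    Measurable fun ω => v ω ⬝ᵥ (A ω)⁻¹ *ᵥ w ω :=
  measurable_quad (measurable_inv_apply hA) hv hw

lemma measurable_matNorm_inv {A : Ω → Matrix (Fin d) (Fin d) ℝ} {v : Ω → Fin d → ℝ}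
    (hA : ∀ i j, Measurable fun ω => A ω i j) (hv : Measurable v) :
    Measurable fun ω => matNorm (A ω)⁻¹ (v ω) :=
  (measurable_quad_inv hA hv hv).sqrt

lemma measurable_regGram_apply (ρ : ℝ) {x : ℕ → Ω → Fin d → ℝ} {k : ℕ}
    (hx : ∀ τ ∈ Finset.Icc 1 k, Measurable (x τ)) (i j : Fin d) :
    Measurable fun ω => regGram ρ (fun τ => x τ ω) k i j := by
  simp only [regGram, Matrix.add_apply, Matrix.sum_apply, Matrix.vecMulVec_apply]
  refine measurable_const.add (Finset.measurable_sum _ fun τ hτ => ?_)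
  exact ((measurable_pi_apply i).comp (hx τ hτ)).mul ((measurable_pi_apply j).comp (hx τ hτ))

/-- The uncountably many inequalities defining positive semidefiniteness cut out a closed set of
matrices, and closed sets are Borel. -/
lemma measurableSet_posSemidef {A : Ω → Matrix (Fin d) (Fin d) ℝ}
    (hA : ∀ i j, Measurable fun ω => A ω i j) : MeasurableSet {ω | (A ω).PosSemidef} := by
  have hcl : IsClosed {B : Fin d → Fin d → ℝ | (Matrix.of B).PosSemidef} := by
    have : {B : Fin d → Fin d → ℝ | (Matrix.of B).PosSemidef}
        = (⋂ i, ⋂ j, {B | B i j = B j i}) ∩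
          ⋂ v : Fin d → ℝ, {B | 0 ≤ ∑ i, v i * ∑ j, B i j * v j} := by
      ext B
      simp only [Matrix.posSemidef_iff_dotProduct_mulVec, Set.mem_ofPred_eq, Set.mem_inter_iff,
        Set.mem_iInter, Matrix.IsHermitian, dotProduct, Matrix.mulVec, Pi.star_apply,
        star_trivial, Matrix.of_apply]
      refine and_congr ?_ Iff.rfl
      rw [← Matrix.ext_iff]
      simp only [Matrix.conjTranspose_apply, Matrix.of_apply, star_trivial]
      exact ⟨fun h i j => h j i, fun h i j => h j i⟩
    rw [this]
    refine IsClosed.inter (isClosed_iInter fun i => isClosed_iInter fun j =>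
      isClosed_eq (by fun_prop) (by fun_prop)) (isClosed_iInter fun v =>
      isClosed_le (by fun_prop) (by fun_prop))
  have hm : Measurable fun ω => fun i j => A ω i j :=
    measurable_pi_lambda _ fun i => measurable_pi_lambda _ fun j => hA i j
  exact hm hcl.measurableSet

lemma measurableSet_noiseWithin {ρlo ρhi z : ℝ} {H : Ω → Matrix (Fin d) (Fin d) ℝ}
    {h : Ω → Fin d → ℝ} (hH : ∀ i j, Measurable fun ω => H ω i j) (hh : Measurable h) :
    MeasurableSet {ω | NoiseWithin ρlo ρhi z (H ω) (h ω)} := by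
  have : {ω | NoiseWithin ρlo ρhi z (H ω) (h ω)}
      = {ω | (H ω - ρlo • (1 : Matrix (Fin d) (Fin d) ℝ)).PosSemidef}
        ∩ ({ω | (ρhi • (1 : Matrix (Fin d) (Fin d) ℝ) - H ω).PosSemidef}
        ∩ {ω | matNorm (H ω)⁻¹ (h ω) ≤ z}) := by
    ext ω
    exact ⟨fun h => ⟨h.1, h.2, h.3⟩, fun h => ⟨h.1, h.2.1, h.2.2⟩⟩
  rw [this]
  refine (measurableSet_posSemidef fun i j => ?_).inter
    ((measurableSet_posSemidef fun i j => ?_).inter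
      (measurableSet_le (measurable_matNorm_inv hH hh) measurable_const))
  · exact (hH i j).sub_const _
  · exact (hH i j).const_sub _

end Measurability

/-- The sum of the vectors `x τ`, weighted with the noise `η τ`, over the first `k` rounds. -/
def noiseSum {d : ℕ} (x : ℕ → Fin d → ℝ) (η : ℕ → ℝ) (k : ℕ) : Fin d → ℝ :=
  ∑ τ ∈ Finset.Icc 1 k, η τ • x τ

/-- The squared dual norm of the noise sum, less the logarithmic growth of the determinant. -/
def selfNorm {d : ℕ} (ρ : ℝ) (x : ℕ → Fin d → ℝ) (η : ℕ → ℝ) (k : ℕ) : ℝ :=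
  noiseSum x η k ⬝ᵥ (regGram ρ x k)⁻¹ *ᵥ noiseSum x η k
    - (Real.log (regGram ρ x k).det - d * Real.log ρ)

section SelfNormalised

variable {d : ℕ} {ρ : ℝ}

lemma noiseSum_succ (x : ℕ → Fin d → ℝ) (η : ℕ → ℝ) (k : ℕ) :
    noiseSum x η (k + 1) = noiseSum x η k + η (k + 1) • x (k + 1) := by
  rw [noiseSum, noiseSum, Finset.sum_Icc_succ_top (by omega)]

lemma selfNorm_zero (x : ℕ → Fin d → ℝ) (η : ℕ → ℝ) : selfNorm ρ x η 0 = 0 := by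
  simp [selfNorm, noiseSum, det_regGram_zero]

/-- The determinant lemma and the rank-one update of the inverse make the increment of the exponent
quadratic in the new noise. The middle factor is exactly the reciprocal of the Gaussian moment of
the last one. -/
lemma exp_selfNorm_succ (hρ : 0 < ρ) (x : ℕ → Fin d → ℝ) (η : ℕ → ℝ) (k : ℕ) {u s : ℝ}
    (hu : u = x (k + 1) ⬝ᵥ (regGram ρ x k)⁻¹ *ᵥ x (k + 1))
    (hs : s = x (k + 1) ⬝ᵥ (regGram ρ x k)⁻¹ *ᵥ noiseSum x η k) :
    Real.exp (selfNorm ρ x η (k + 1) / 2) =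
      Real.exp (selfNorm ρ x η k / 2)
        * (Real.exp (-(s ^ 2 / (2 * (1 + u)))) * (√(1 + u))⁻¹)
        * Real.exp (s / (1 + u) * η (k + 1) + u / (1 + u) * η (k + 1) ^ 2 / 2) := by
  have hA := regGram_posDef (x := x) hρ k
  have hu0 : 0 ≤ u := hu ▸ hA.inv.posSemidef.quad_nonneg _
  have hsq : (√(1 + u))⁻¹ = Real.exp (-(Real.log (1 + u) / 2)) := by
    rw [Real.exp_neg, Real.sqrt_eq_rpow, Real.rpow_def_of_pos (by positivity)]
    ring_nf
  rw [hsq, ← Real.exp_add, ← Real.exp_add, ← Real.exp_add, selfNorm, selfNorm,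
    log_det_regGram_succ hρ, noiseSum_succ, regGram_succ, quad_inv_add_vecMulVec hA, ← hu, ← hs]
  congr 1
  field_simp
  ring

open scoped ENNReal

variable {Ω : Type*} {𝒮 mΩ : MeasurableSpace Ω} {P : Measure Ω}

lemma measurable_selfNorm {x : ℕ → Ω → Fin d → ℝ} {η : ℕ → Ω → ℝ} {k : ℕ}
    (hx : ∀ τ ∈ Finset.Icc 1 k, Measurable (x τ)) (hη : ∀ τ ∈ Finset.Icc 1 k, Measurable (η τ)) :
    Measurable fun ω => selfNorm ρ (fun τ => x τ ω) (fun τ => η τ ω) k := by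
  have hS : Measurable fun ω => noiseSum (fun τ => x τ ω) (fun τ => η τ ω) k := by
    simp only [noiseSum]
    exact Finset.measurable_sum _ fun τ hτ => (hη τ hτ).smul (hx τ hτ)
  exact (measurable_quad_inv (measurable_regGram_apply ρ hx) hS hS).sub
    ((measurable_det (measurable_regGram_apply ρ hx)).log.sub_const _)

/-- One step of the self-normalised supermartingale: `𝒮` is the information available before the
noise of round `k + 1`. -/
lemma setLIntegral_exp_selfNorm_succ_le [IsProbabilityMeasure P] (hρ : 0 < ρ) (h𝒮 : 𝒮 ≤ mΩ)
    {x : ℕ → Ω → Fin d → ℝ}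
    {η : ℕ → Ω → ℝ} {k : ℕ} (hx : ∀ τ ∈ Finset.Icc 1 (k + 1), Measurable[𝒮] (x τ))
    (hη : ∀ τ ∈ Finset.Icc 1 k, Measurable[𝒮] (η τ)) (hηm : Measurable (η (k + 1)))
    (hsub : HasSubgaussianMGF (η (k + 1)) 1 P)
    (hind : Indep (MeasurableSpace.comap (η (k + 1)) inferInstance) 𝒮 P)
    {A : Set Ω} (hA : MeasurableSet[𝒮] A) :
    ∫⁻ ω in A, ENNReal.ofReal
        (Real.exp (selfNorm ρ (fun τ => x τ ω) (fun τ => η τ ω) (k + 1) / 2)) ∂P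
      ≤ ∫⁻ ω in A, ENNReal.ofReal
        (Real.exp (selfNorm ρ (fun τ => x τ ω) (fun τ => η τ ω) k / 2)) ∂P := by
  have hx' : ∀ τ ∈ Finset.Icc 1 k, Measurable[𝒮] (x τ) := fun τ hτ =>
    hx τ (Finset.Icc_subset_Icc_right (by omega) hτ)
  have hxk := hx (k + 1) (by simp)
  set u : Ω → ℝ := fun ω =>
    x (k + 1) ω ⬝ᵥ (regGram ρ (fun τ => x τ ω) k)⁻¹ *ᵥ x (k + 1) ω with hu
  set s : Ω → ℝ := fun ω =>
    x (k + 1) ω ⬝ᵥ (regGram ρ (fun τ => x τ ω) k)⁻¹ *ᵥ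
      noiseSum (fun τ => x τ ω) (fun τ => η τ ω) k with hs
  have hS : Measurable[𝒮] fun ω => noiseSum (fun τ => x τ ω) (fun τ => η τ ω) k := by
    simp only [noiseSum]
    exact Finset.measurable_sum _ fun τ hτ => (hη τ hτ).smul (hx' τ hτ)
  have hum : Measurable[𝒮] u := measurable_quad_inv (measurable_regGram_apply ρ hx') hxk hxk
  have hsm : Measurable[𝒮] s := measurable_quad_inv (measurable_regGram_apply ρ hx') hxk hS
  have hu0 : ∀ ω, 0 ≤ u ω := fun ω =>
    (regGram_posDef (x := fun τ => x τ ω) hρ k).inv.posSemidef.quad_nonneg _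
  have hum1 : Measurable[𝒮] fun ω => 1 + u ω := hum.const_add 1
  set E : Ω → ℝ := fun ω => Real.exp (selfNorm ρ (fun τ => x τ ω) (fun τ => η τ ω) k / 2) with hE
  have hEm : Measurable[𝒮] E :=
    Real.measurable_exp.comp ((measurable_selfNorm hx' hη).div_const 2)
  -- With a = s/(1+u) and b = u/(1+u) one has 1 - b = 1/(1+u), so the moment bound is √(1+u)
  -- exp(s²/(2(1+u))). This factor cancels it, which gives the supermartingale property.
  set c : Ω → ℝ := fun ω => Real.exp (-(s ω ^ 2 / (2 * (1 + u ω)))) * (√(1 + u ω))⁻¹ with hc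
  have hcm : Measurable[𝒮] c :=
    (Real.measurable_exp.comp ((hsm.pow_const 2).div (hum1.const_mul 2)).neg).mul hum1.sqrt.inv
  have hc0 : ∀ ω, 0 ≤ c ω := fun ω => by positivity
  set M : Ω → ℝ≥0∞ := A.indicator fun ω => ENNReal.ofReal (E ω * c ω) with hM
  have hMm : Measurable[𝒮] M := ((hEm.mul hcm).ennreal_ofReal).indicator hA
  have key := lintegral_mul_exp_quadratic_le h𝒮 hηm hsub hind hMm (a := fun ω => s ω / (1 + u ω))
    (b := fun ω => u ω / (1 + u ω)) (hsm.div hum1) (hum.div hum1)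
    (fun ω => div_nonneg (hu0 ω) (by linarith [hu0 ω]))
    (fun ω => by rw [div_lt_one (by linarith [hu0 ω])]; linarith)
  rw [← lintegral_indicator (h𝒮 _ hA), ← lintegral_indicator (h𝒮 _ hA)]
  refine (le_of_eq (lintegral_congr fun ω => ?_)).trans
    (key.trans (le_of_eq (lintegral_congr fun ω => ?_)))
  · by_cases hω : ω ∈ A
    · simp only [hM, Set.indicator_of_mem hω]
      rw [← ENNReal.ofReal_mul (mul_nonneg (Real.exp_pos _).le (hc0 ω)),
        exp_selfNorm_succ hρ _ _ k (u := u ω) (s := s ω) rfl rfl]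
    · simp only [hM, Set.indicator_of_notMem hω, zero_mul]
  · by_cases hω : ω ∈ A
    · simp only [hM, Set.indicator_of_mem hω]
      rw [← ENNReal.ofReal_mul (mul_nonneg (Real.exp_pos _).le (hc0 ω)), mul_assoc]
      congr 1
      have h1 : 0 < 1 + u ω := by linarith [hu0 ω]
      have h2 : 1 - u ω / (1 + u ω) = (1 + u ω)⁻¹ := by field_simp; ring
      rw [h2, Real.sqrt_inv, inv_inv]
      have h3 : (s ω / (1 + u ω)) ^ 2 / (2 * (1 + u ω)⁻¹) = s ω ^ 2 / (2 * (1 + u ω)) := by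
        field_simp
      have h4 := Real.sqrt_pos.2 h1
      have h5 : c ω * (√(1 + u ω) * Real.exp (s ω ^ 2 / (2 * (1 + u ω)))) = 1 := by
        simp only [hc, Real.exp_neg]
        field_simp
      rw [h3, h5, mul_one]
    · simp only [hM, Set.indicator_of_notMem hω, zero_mul]

end SelfNormalised

/-! ### The noise of a run -/

lemma _root_.ProbabilityTheory.HasSubgaussianMGF.div_self_const {Ω : Type*}
    {mΩ : MeasurableSpace Ω} {P : Measure Ω} {X : Ω → ℝ} {σ : ℝ≥0} (hσ : σ ≠ 0)
    (h : HasSubgaussianMGF X (σ ^ 2) P) : HasSubgaussianMGF (fun ω => X ω / σ) 1 P where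
  integrable_exp_mul t := by
    refine (h.integrable_exp_mul (t / σ)).congr (ae_of_all _ fun ω => ?_)
    ring_nf
  mgf_le t := by
    have hσ' : (σ : ℝ) ≠ 0 := by exact_mod_cast hσ
    have h1 := h.mgf_le (t / σ)
    have e1 : mgf (fun ω => X ω / σ) P t = mgf X P (t / σ) := by
      simp only [mgf]
      congr 1; ext ω; ring_nf
    have e2 : ((σ ^ 2 : ℝ≥0) : ℝ) * (t / σ) ^ 2 / 2 = ((1 : ℝ≥0) : ℝ) * t ^ 2 / 2 := by
      push_cast; field_simp
    rwa [e1, ← e2]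

/-- Used for quantities evaluated at the arm drawn, such as its context: finitely many arms split
the sample space into measurable pieces. -/
lemma measurable_apply_of_finite {Ω D E : Type*} [Finite D] [MeasurableSpace E]
    {mΩ : MeasurableSpace Ω} {F : D → Ω → E} {g : Ω → D} (hF : ∀ a, Measurable (F a))
    (hg : Measurable[mΩ, ⊤] g) : Measurable fun ω => F (g ω) ω := by
  intro s hs
  have : (fun ω => F (g ω) ω) ⁻¹' s = ⋃ a, g ⁻¹' {a} ∩ F a ⁻¹' s := by
    ext ω; simp
  rw [this]
  exact MeasurableSet.iUnion fun a =>
    (hg (MeasurableSpace.measurableSet_top (s := {a}))).inter (hF a hs)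

lemma noiseSum_div {d : ℕ} (x : ℕ → Fin d → ℝ) (η : ℕ → ℝ) (σ : ℝ) (k : ℕ) :
    noiseSum x (fun τ => η τ / σ) k = σ⁻¹ • noiseSum x η k := by
  simp only [noiseSum, Finset.smul_sum, smul_smul]
  exact Finset.sum_congr rfl fun τ _ => by rw [div_eq_inv_mul]

/-- Jensen's inequality for a sum of exponentials. -/
lemma sum_le_of_sum_exp_le {ι : Type*} (s : Finset ι) (y : ι → ℝ) {K : ℝ} (hK : 0 < K)
    (h : ∑ i ∈ s, Real.exp (y i) ≤ s.card * K) : ∑ i ∈ s, y i ≤ s.card * Real.log K := by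
  have h1 : ∀ i ∈ s, K * (y i - Real.log K + 1) ≤ Real.exp (y i) := fun i _ => by
    have h2 := Real.add_one_le_exp (y i - Real.log K)
    rw [Real.exp_sub, Real.exp_log hK, le_div_iff₀ hK] at h2
    linarith
  have h3 := (Finset.sum_le_sum h1).trans h
  rw [← Finset.mul_sum, Finset.sum_add_distrib, Finset.sum_sub_distrib] at h3
  simp only [Finset.sum_const, nsmul_eq_mul, mul_one] at h3
  nlinarith

namespace Run

variable {Ω D : Type*} {m d : ℕ} {R : Run Ω D m d} [Fintype D] {𝒮 mΩ : MeasurableSpace Ω}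
  {P : Measure Ω} {ℱ : Filtration ℕ mΩ} {T : ℕ} {lam : ℝ} {f : Fin m → ℝ → ℝ}
  {θstar : Fin d → ℝ} {σ : ℝ≥0} {rad : ℕ → ℝ}

lemma IsPrivFairX.measurable_chosen_of_le (hR : R.IsPrivFairX P ℱ T lam f θstar σ rad) {t : ℕ}
    (ht : t ∈ Finset.Icc 1 T) (i : Fin m) (h𝒮 : ℱ t ≤ 𝒮)
    (hact : Measurable[𝒮, ⊤] (R.act t i)) : Measurable[𝒮] (R.chosen t i) :=
  measurable_apply_of_finite (F := fun a ω => R.ctx t i a ω) (fun a => (hR.meas_ctx t ht i a).mono h𝒮 le_rfl) hact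

lemma IsPrivFairX.measurable_chosen (hR : R.IsPrivFairX P ℱ T lam f θstar σ rad) {t : ℕ}
    (ht : t ∈ Finset.Icc 1 T) (i : Fin m) : Measurable[ℱ (t + 1)] (R.chosen t i) :=
  hR.measurable_chosen_of_le ht i (ℱ.mono (by omega)) (hR.meas_act t ht i)

lemma measurable_act_sup {D : Type*} (R : Run Ω D m d) (ℱ : Filtration ℕ mΩ) (t : ℕ) (i : Fin m) :
    Measurable[ℱ t ⊔ MeasurableSpace.comap (fun ω i => R.act t i ω) ⊤, ⊤] (R.act t i) := by
  intro s _
  refine (le_sup_right : _ ≤ ℱ t ⊔ _) _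
    ⟨{arms | arms i ∈ s}, MeasurableSpace.measurableSet_top, rfl⟩

lemma IsPrivFairX.comap_act_le (hR : R.IsPrivFairX P ℱ T lam f θstar σ rad) {t : ℕ}
    (ht : t ∈ Finset.Icc 1 T) :
    MeasurableSpace.comap (fun ω i => R.act t i ω) ⊤ ≤ mΩ := by
  rintro _ ⟨s, -, rfl⟩
  have : (fun ω i => R.act t i ω) ⁻¹' s = ⋃ arms ∈ s, ⋂ i, R.act t i ⁻¹' {arms i} := by
    ext ω
    simp only [Set.mem_preimage, Set.mem_iUnion, Set.mem_iInter, Set.mem_singleton_iff]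
    exact ⟨fun h => ⟨_, h, fun i => rfl⟩, fun ⟨arms, h, h'⟩ => by rwa [funext h']⟩
  rw [this]
  exact MeasurableSet.biUnion (Set.to_countable _) fun arms _ => MeasurableSet.iInter fun i =>
    ℱ.le _ _ (hR.meas_act t ht i (MeasurableSpace.measurableSet_top (s := {arms i})))

/-- The squared dual norm of the noise sum of agent `j` over the first `k` rounds. -/
def noiseNormSq (R : Run Ω D m d) (ρ : ℝ) (k : ℕ) (j : Fin m) (ω : Ω) : ℝ :=
  noiseSum (fun τ => R.chosen τ j ω) (fun τ => R.eta τ j ω) k ⬝ᵥ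
    (regGram ρ (fun τ => R.chosen τ j ω) k)⁻¹ *ᵥ
      noiseSum (fun τ => R.chosen τ j ω) (fun τ => R.eta τ j ω) k

/-- With high probability the noise sums of all agents are jointly bounded in all rounds, with
unit-variance noise. -/
lemma IsPrivFairX.measureReal_exists_le_sum_exp [IsProbabilityMeasure P]
    (hR : R.IsPrivFairX P ℱ T lam f θstar σ rad)
    (hσ : σ ≠ 0) {ρ α : ℝ} (hρ : 0 < ρ) (hm : 0 < m) (hα : 0 < α) :
    P.real {ω | ∃ k ≤ T, m * (2 / α) ≤ ∑ j, Real.exp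
      (selfNorm ρ (fun τ => R.chosen τ j ω) (fun τ => R.eta τ j ω / σ) k / 2)} ≤ α / 2 := by
  have hm' : (0 : ℝ) < m := by exact_mod_cast hm
  have hmem : ∀ {k τ}, τ ∈ Finset.Icc 1 k → k ≤ T → 1 ≤ τ ∧ τ ≤ k ∧ τ ∈ Finset.Icc 1 T := by
    intro k τ hτ hk
    have := Finset.mem_Icc.1 hτ
    exact ⟨this.1, this.2, Finset.mem_Icc.2 ⟨this.1, this.2.trans hk⟩⟩
  set M : ℕ → Ω → ENNReal := fun k ω => ∑ j, ENNReal.ofReal (Real.exp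
      (selfNorm ρ (fun τ => R.chosen τ j ω) (fun τ => R.eta τ j ω / σ) k / 2)) with hM
  -- The index is shifted: `ℱ (k + 1)` is the information just before the draws of round k + 1, and
  -- so contains the noise of round k.
  have hMj : ∀ j, ∀ k ≤ T, Measurable[ℱ (k + 1)] fun ω => ENNReal.ofReal (Real.exp
      (selfNorm ρ (fun τ => R.chosen τ j ω) (fun τ => R.eta τ j ω / σ) k / 2)) := by
    intro j k hk
    refine Measurable.ennreal_ofReal (Real.measurable_exp.comp
      ((measurable_selfNorm (x := fun τ => R.chosen τ j) (η := fun τ ω => R.eta τ j ω / σ)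
        (fun τ hτ => ?_) (fun τ hτ => ?_)).div_const 2))
    · obtain ⟨-, h2, h3⟩ := hmem hτ hk
      exact (hR.measurable_chosen h3 j).mono (ℱ.mono (by omega)) le_rfl
    · obtain ⟨-, h2, h3⟩ := hmem hτ hk
      exact ((hR.meas_eta τ h3 j).mono (ℱ.mono (by omega)) le_rfl).div_const _
  have hMm : ∀ k ≤ T, Measurable[ℱ (k + 1)] (M k) := fun k hk =>
    Finset.measurable_sum _ fun j _ => hMj j k hk
  have hville := mul_measure_exists_le (P := P) (𝒢 := fun k => ℱ (k + 1))
    (fun a b hab => ℱ.mono (by omega)) (fun k => ℱ.le _) hMm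
    (fun k hk A hA => by
      have hk1 : k + 1 ∈ Finset.Icc 1 T := Finset.mem_Icc.2 ⟨by omega, hk⟩
      simp only [hM]
      rw [lintegral_finsetSum _ fun j _ => (hMj j (k + 1) hk).mono (ℱ.le _) le_rfl,
        lintegral_finsetSum _ fun j _ => (hMj j k hk.le).mono (ℱ.le _) le_rfl]
      refine Finset.sum_le_sum fun j _ => ?_
      -- The context chosen in round k + 1 also depends on the arm drawn there, so the arms are
      -- adjoined; the reward noise is still independent of the enlarged σ-algebra.
      refine setLIntegral_exp_selfNorm_succ_le (ρ := ρ) (η := fun τ ω => R.eta τ j ω / σ)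
        (x := fun τ => R.chosen τ j)
        (𝒮 := ℱ (k + 1) ⊔ MeasurableSpace.comap (fun ω i => R.act (k + 1) i ω) ⊤) hρ
        (sup_le (ℱ.le _) (hR.comap_act_le hk1)) (fun τ hτ => ?_) (fun τ hτ => ?_)
        (((hR.meas_eta _ hk1 j).mono (ℱ.le _) le_rfl).div_const _)
        ((hR.noise_subgaussian _ hk1 j).div_self_const hσ) ?_
        ((le_sup_left : ℱ (k + 1) ≤ _) _ hA)
      · obtain ⟨-, h2, h3⟩ := hmem hτ hk
        rcases Nat.lt_or_ge τ (k + 1) with h | h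
        · exact (hR.measurable_chosen h3 j).mono
            ((ℱ.mono (by omega)).trans le_sup_left) le_rfl
        · obtain rfl : τ = k + 1 := by omega
          exact hR.measurable_chosen_of_le h3 j le_sup_left (R.measurable_act_sup ℱ _ j)
      · obtain ⟨-, h2, h3⟩ := hmem hτ hk.le
        exact ((hR.meas_eta τ h3 j).mono ((ℱ.mono (by omega)).trans le_sup_left)
          le_rfl).div_const _
      · refine indep_of_indep_of_le_left (hR.noise_indep_past _ hk1) ?_
        refine le_trans ?_ (le_iSup _ j)
        have : Measurable[MeasurableSpace.comap (R.eta (k + 1) j) inferInstance]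
            fun ω => R.eta (k + 1) j ω / (σ : ℝ) :=
          (comap_measurable (R.eta (k + 1) j)).div_const _
        exact this.comap_le) (ENNReal.ofReal (m * (2 / α)))
  have hM0 : ∫⁻ ω, M 0 ω ∂P = ENNReal.ofReal m := by
    simp [hM, selfNorm_zero]
  rw [hM0] at hville
  have hset : {ω | ∃ k ≤ T, m * (2 / α) ≤ ∑ j, Real.exp
      (selfNorm ρ (fun τ => R.chosen τ j ω) (fun τ => R.eta τ j ω / σ) k / 2)}
      = {ω | ∃ k ≤ T, ENNReal.ofReal (m * (2 / α)) ≤ M k ω} := by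
    ext ω
    simp only [Set.mem_ofPred_eq, hM]
    refine exists_congr fun k => and_congr_right fun _ => ?_
    rw [← ENNReal.ofReal_sum_of_nonneg fun j _ => (Real.exp_pos _).le,
      ENNReal.ofReal_le_ofReal_iff (Finset.sum_nonneg fun j _ => (Real.exp_pos _).le)]
  rw [hset]
  have h1 := ENNReal.toReal_mono ENNReal.ofReal_ne_top hville
  rw [ENNReal.toReal_mul, ENNReal.toReal_ofReal (by positivity),
    ENNReal.toReal_ofReal hm'.le] at h1
  change (m * (2 / α)) * P.real _ ≤ m at h1
  have h2 : m * (2 / α) * (α / 2) = (m : ℝ) := by field_simp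
  exact le_of_mul_le_mul_left (h1.trans_eq h2.symm) (by positivity)

/-- With high probability the noise sums of all agents are jointly bounded in all rounds. -/
lemma IsPrivFairX.measureReal_exists_lt_sum_noiseNormSq [IsProbabilityMeasure P]
    (hR : R.IsPrivFairX P ℱ T lam f θstar σ rad) {ρ α : ℝ} (hρ : 0 < ρ) (hm : 0 < m) (hd : 0 < d)
    (hα : 0 < α)
    (hx : ∀ t ∈ Finset.Icc 1 T, ∀ i ω, R.chosen t i ω ⬝ᵥ R.chosen t i ω ≤ 1) :
    P.real {ω | ∃ k ≤ T, m * (σ ^ 2 * (2 * Real.log (2 / α) + d * Real.log (1 + T / (d * ρ))))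
      < ∑ j, R.noiseNormSq ρ k j ω} ≤ α / 2 := by
  have hd' : (0 : ℝ) < d := by exact_mod_cast hd
  -- For σ = 0 the noise cannot be normalised, but then it vanishes almost surely.
  rcases eq_or_ne σ 0 with rfl | hσ
  · have h0 : P {ω | ∃ k ≤ T, m * (((0 : ℝ≥0) : ℝ) ^ 2 *
        (2 * Real.log (2 / α) + d * Real.log (1 + T / (d * ρ))))
        < ∑ j, R.noiseNormSq ρ k j ω} = 0 := by
      have hae : ∀ᵐ ω ∂P, ∀ t ∈ Finset.Icc 1 T, ∀ j, R.eta t j ω = 0 := by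
        refine (ae_ball_iff (Finset.countable_toSet (Finset.Icc 1 T))).2 ?_
        intro t ht
        rw [ae_all_iff]
        intro j
        have := hR.noise_subgaussian t ht j
        rw [zero_pow two_ne_zero] at this
        exact this.ae_eq_zero_of_hasSubgaussianMGF_zero
      refine measure_mono_null ?_ hae
      rintro ω ⟨k, hk, h⟩ hall
      have : ∀ j, R.noiseNormSq ρ k j ω = 0 := by
        intro j
        have : noiseSum (fun τ => R.chosen τ j ω) (fun τ => R.eta τ j ω) k = 0 := by
          refine Finset.sum_eq_zero fun τ hτ => ?_
          simp only [hall τ (Finset.Icc_subset_Icc_right hk hτ) j, zero_smul]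
        simp [noiseNormSq, this]
      simp [this] at h
    rw [measureReal_def, h0]
    simp; positivity
  refine (measureReal_mono ?_).trans (hR.measureReal_exists_le_sum_exp hσ hρ hm hα)
  rintro ω ⟨k, hk, h⟩
  refine ⟨k, hk, ?_⟩
  by_contra! hc
  refine h.not_ge ?_
  -- Bounding the sum of exponentials by 2m/α bounds the sum of exponents by m log(2/α). A union
  -- bound would have put log(2m/α) in its place.
  have h1 := sum_le_of_sum_exp_le Finset.univ (fun j : Fin m =>
    selfNorm ρ (fun τ => R.chosen τ j ω) (fun τ => R.eta τ j ω / σ) k / 2) (K := 2 / α) (by positivity)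
    (by simpa using hc.le)
  rw [← Finset.sum_div, div_le_iff₀ two_pos, Finset.card_univ, Fintype.card_fin] at h1
  have hσ' : (0 : ℝ) < σ := by exact_mod_cast pos_iff_ne_zero.2 hσ
  have h2 : ∀ j, R.noiseNormSq ρ k j ω ≤ σ ^ 2 *
      (selfNorm ρ (fun τ => R.chosen τ j ω) (fun τ => R.eta τ j ω / σ) k
        + d * Real.log (1 + T / (d * ρ))) := by
    intro j
    have h3 := log_det_regGram_sub_le (x := fun τ => R.chosen τ j ω) hρ hd (k := k)
      fun τ hτ => hx τ (Finset.Icc_subset_Icc_right hk hτ) j ω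
    have h4 : (d : ℝ) * Real.log (1 + k / (d * ρ)) ≤ d * Real.log (1 + T / (d * ρ)) := by
      have : (k : ℝ) ≤ T := by exact_mod_cast hk
      gcongr
    have h5 : R.noiseNormSq ρ k j ω = σ ^ 2 *
        (selfNorm ρ (fun τ => R.chosen τ j ω) (fun τ => R.eta τ j ω / σ) k
          + (Real.log (regGram ρ (fun τ => R.chosen τ j ω) k).det - d * Real.log ρ)) := by
      rw [selfNorm, noiseSum_div, noiseNormSq, Matrix.mulVec_smul, smul_dotProduct,
        dotProduct_smul, smul_eq_mul, smul_eq_mul]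
      field_simp
      ring
    rw [h5]
    gcongr
    linarith
  calc ∑ j, R.noiseNormSq ρ k j ω ≤ ∑ j, σ ^ 2 *
      (selfNorm ρ (fun τ => R.chosen τ j ω) (fun τ => R.eta τ j ω / σ) k
        + d * Real.log (1 + T / (d * ρ))) := Finset.sum_le_sum fun j _ => h2 j
    _ = σ ^ 2 * (∑ j, selfNorm ρ (fun τ => R.chosen τ j ω) (fun τ => R.eta τ j ω / σ) k
        + m * (d * Real.log (1 + T / (d * ρ)))) := by
      rw [← Finset.mul_sum, Finset.sum_add_distrib]
      simp
    _ ≤ σ ^ 2 * (m * Real.log (2 / α) * 2 + m * (d * Real.log (1 + T / (d * ρ)))) := by gcongr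
    _ = _ := by ring

end Run

/-! ### Merit policies -/

section Merit

variable {D : Type*} [Fintype D] {d : ℕ} {f : ℝ → ℝ} {γ L : ℝ}

lemma IsMerit.continuous (hf : IsMerit γ L f) (hL : 0 < L) : Continuous f := by
  have : LipschitzWith L.toNNReal f := LipschitzWith.of_dist_le_mul fun u v => by
    rw [Real.dist_eq, Real.dist_eq, Real.coe_toNNReal _ hL.le]
    exact hf.lipschitz u v
  exact this.continuous

lemma IsMerit.meritPolicy_nonneg (hf : IsMerit γ L f) (hγ : 0 < γ) (x : D → Fin d → ℝ)
    (θ : Fin d → ℝ) (a : D) : 0 ≤ meritPolicy f x θ a :=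
  div_nonneg (hγ.le.trans (hf.min_merit _))
    (Finset.sum_nonneg fun _ _ => hγ.le.trans (hf.min_merit _))

lemma IsMerit.sum_merit_pos [Nonempty D] (hf : IsMerit γ L f) (hγ : 0 < γ) (x : D → Fin d → ℝ)
    (θ : Fin d → ℝ) : 0 < ∑ a, f (θ ⬝ᵥ x a) :=
  Finset.sum_pos (fun _ _ => hγ.trans_le (hf.min_merit _)) Finset.univ_nonempty

lemma IsMerit.sum_meritPolicy [Nonempty D] (hf : IsMerit γ L f) (hγ : 0 < γ)
    (x : D → Fin d → ℝ) (θ : Fin d → ℝ) : ∑ a, meritPolicy f x θ a = 1 := by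
  simp only [meritPolicy]
  rw [← Finset.sum_div, div_self (hf.sum_merit_pos hγ x θ).ne']

/-- The merit policies of two parameters are close if the parameters are close in the directions
of the contexts. -/
lemma IsMerit.sum_abs_meritPolicy_sub_le [Nonempty D] (hf : IsMerit γ L f) (hγ : 0 < γ)
    (x : D → Fin d → ℝ) (θ θ' : Fin d → ℝ) :
    ∑ a, |meritPolicy f x θ' a - meritPolicy f x θ a|
      ≤ 2 * L / γ * ∑ a, meritPolicy f x θ a * |(θ' - θ) ⬝ᵥ x a| := by
  have hF := hf.sum_merit_pos hγ x θ
  have hF' := hf.sum_merit_pos hγ x θ'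
  set F := ∑ a, f (θ ⬝ᵥ x a) with hFdef
  set F' := ∑ a, f (θ' ⬝ᵥ x a) with hFdef'
  set e : D → ℝ := fun a => |f (θ' ⬝ᵥ x a) - f (θ ⬝ᵥ x a)| with he
  have hFF : |F - F'| ≤ ∑ a, e a := by
    rw [hFdef, hFdef', ← Finset.sum_sub_distrib]
    refine (Finset.abs_sum_le_sum_abs _ _).trans (Finset.sum_le_sum fun a _ => ?_)
    rw [abs_sub_comm]
  have h1 : ∀ a, |meritPolicy f x θ' a - meritPolicy f x θ a|
      ≤ e a / F + f (θ' ⬝ᵥ x a) / F' * ((∑ a, e a) / F) := by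
    intro a
    have h0 : 0 ≤ f (θ' ⬝ᵥ x a) := hγ.le.trans (hf.min_merit _)
    -- The first term changes the numerator, the second the normalisation. The weights f(θ'·x a)/F'
    -- sum to one, so each contributes at most (Σ e)/F in total.
    have : meritPolicy f x θ' a - meritPolicy f x θ a
        = (f (θ' ⬝ᵥ x a) - f (θ ⬝ᵥ x a)) / F + f (θ' ⬝ᵥ x a) / F' * ((F - F') / F) := by
      simp only [meritPolicy, ← hFdef, ← hFdef']
      field_simp
      ring
    rw [this]
    refine (abs_add_le _ _).trans (add_le_add ?_ ?_)
    · rw [abs_div, abs_of_pos hF]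
    · rw [abs_mul, abs_div (F - F'), abs_of_pos hF, abs_of_nonneg (div_nonneg h0 hF'.le)]
      gcongr
  have h2 : ∑ a, |meritPolicy f x θ' a - meritPolicy f x θ a| ≤ 2 * ((∑ a, e a) / F) := by
    refine (Finset.sum_le_sum fun a _ => h1 a).trans (le_of_eq ?_)
    rw [Finset.sum_add_distrib, ← Finset.sum_div, ← Finset.sum_mul, ← Finset.sum_div, ← hFdef',
      div_self hF'.ne']
    ring
  refine h2.trans ?_
  have h3 : (∑ a, e a) / F ≤ L / γ * ∑ a, meritPolicy f x θ a * |(θ' - θ) ⬝ᵥ x a| := by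
    rw [Finset.sum_div, Finset.mul_sum]
    refine Finset.sum_le_sum fun a _ => ?_
    have hl := hf.lipschitz (θ' ⬝ᵥ x a) (θ ⬝ᵥ x a)
    rw [← sub_dotProduct] at hl
    have hg := hf.min_merit (θ ⬝ᵥ x a)
    have hLe : 0 ≤ L * |(θ' - θ) ⬝ᵥ x a| := (abs_nonneg _).trans hl
    -- Since γ ≤ f(θ·x a), inserting the factor f/γ turns the unweighted sum over arms into an
    -- average under the policy of θ; no factor |D| appears.
    calc e a / F ≤ L * |(θ' - θ) ⬝ᵥ x a| / F := by gcongr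
      _ = γ / γ * (L * |(θ' - θ) ⬝ᵥ x a|) / F := by rw [div_self hγ.ne', one_mul]
      _ ≤ f (θ ⬝ᵥ x a) / γ * (L * |(θ' - θ) ⬝ᵥ x a|) / F := by gcongr
      _ = L / γ * (meritPolicy f x θ a * |(θ' - θ) ⬝ᵥ x a|) := by
        simp only [meritPolicy, ← hFdef]
        ring
  calc 2 * ((∑ a, e a) / F) ≤ 2 * (L / γ * ∑ a, meritPolicy f x θ a * |(θ' - θ) ⬝ᵥ x a|) := by
        gcongr
    _ = _ := by ring

end Merit

/-! ### Confidence -/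

section LastSync

variable {m d T t : ℕ}

lemma lastSync_lt (ht : 1 ≤ t) : lastSync m d T t < t := by
  rw [lastSync, Finset.sup_lt_iff (by simpa using Nat.pos_of_ne_zero (by omega))]
  intro s hs
  exact (Finset.mem_filter.1 hs).2

lemma lastSync_mem (h : lastSync m d T t ≠ 0) : lastSync m d T t ∈ syncRounds m d T := by
  have hne : ((syncRounds m d T).filter fun s => s < t).Nonempty := by
    rw [Finset.nonempty_iff_ne_empty]
    intro he
    exact h (by rw [lastSync, he]; rfl)
  obtain ⟨s, hs, hs'⟩ := Finset.exists_mem_eq_sup _ hne id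
  rw [lastSync, hs']
  exact (Finset.mem_filter.1 hs).1

lemma syncRounds_subset : syncRounds m d T ⊆ Finset.Icc 1 T := by
  classical exact Finset.filter_subset _ _

lemma one_mem_syncRounds (hT : 1 ≤ T) : 1 ∈ syncRounds m d T := by
  simp only [syncRounds, Finset.mem_filter, Finset.mem_Icc]
  exact ⟨⟨le_rfl, hT⟩, 0, rfl⟩

lemma lastSync_ne_zero (hT : 1 ≤ T) (ht : 1 < t) : lastSync m d T t ≠ 0 := by
  have : id 1 ≤ lastSync m d T t :=
    Finset.le_sup (f := id) (Finset.mem_filter.2 ⟨one_mem_syncRounds hT, ht⟩)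
  simp only [id] at this
  omega

end LastSync

section SqrtBeta

variable {m d T : ℕ} {σ α c ρlo ρhi z : ℝ}

lemma sqrtBeta_mono (hσ : 0 ≤ σ) (hρ : 0 < ρlo) (hρ' : ρlo ≤ ρhi) {t : ℕ} (ht : t ≤ T) :
    sqrtBeta m d σ α c ρlo ρhi z t ≤ sqrtBeta m d σ α c ρlo ρhi z T := by
  have h1 : (t : ℝ) ≤ T := by exact_mod_cast ht
  have h2 : 0 < ρhi / ρlo := div_pos (hρ.trans_le hρ') hρ
  rw [sqrtBeta, sqrtBeta]
  gcongr

end SqrtBeta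

namespace Run

variable {Ω D : Type*} {m d : ℕ} {R : Run Ω D m d} {T : ℕ} {lam : ℝ}
  {θstar : Fin d → ℝ} {ω : Ω} {t : ℕ} {i : Fin m}

lemma sum_Icc_add_sum_Ico {E : Type*} [AddCommMonoid E] (g : ℕ → E) {s t : ℕ} (hst : s < t) :
    ∑ τ ∈ Finset.Icc 1 s, g τ + ∑ τ ∈ Finset.Ico (s + 1) t, g τ
      = ∑ τ ∈ Finset.Icc 1 (t - 1), g τ := by
  have h1 : Finset.Icc 1 s = Finset.Ico 1 (s + 1) := by ext; simp
  have h2 : Finset.Icc 1 (t - 1) = Finset.Ico 1 t := by ext; simp; omega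
  rw [h1, h2, Finset.sum_Ico_consecutive _ (by omega) (by omega)]

lemma quad_V (h : lastSync m d T t ≠ 0) (v : Fin d → ℝ) :
    v ⬝ᵥ R.V T lam t i ω *ᵥ v =
      ∑ j, (∑ τ ∈ Finset.Icc 1 (lastSync m d T t), (v ⬝ᵥ R.chosen τ j ω) ^ 2
          + v ⬝ᵥ R.H (lastSync m d T t) j ω *ᵥ v)
        + ∑ τ ∈ Finset.Ico (lastSync m d T t + 1) t, (v ⬝ᵥ R.chosen τ i ω) ^ 2 := by
  simp only [V, if_neg h, privGram, Matrix.add_mulVec, Matrix.sum_mulVec, dotProduct_add,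
    dotProduct_sum, quad_vecMulVec]

lemma V_transpose (h : lastSync m d T t ≠ 0)
    (hH : ∀ j, (R.H (lastSync m d T t) j ω)ᵀ = R.H (lastSync m d T t) j ω) :
    (R.V T lam t i ω)ᵀ = R.V T lam t i ω := by
  simp only [V, if_neg h, privGram, Matrix.transpose_add, Matrix.transpose_sum,
    Matrix.transpose_vecMulVec, hH]

/-- The error of the least squares estimate, before applying the inverse. -/
lemma b_sub_V_mulVec (h : lastSync m d T t ≠ 0) (ht : 1 ≤ t) :
    R.b T θstar t i ω - R.V T lam t i ω *ᵥ θstar =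
      ∑ j, (noiseSum (fun τ => R.chosen τ j ω) (fun τ => R.eta τ j ω) (lastSync m d T t)
          + R.h (lastSync m d T t) j ω - R.H (lastSync m d T t) j ω *ᵥ θstar)
        + (noiseSum (fun τ => R.chosen τ i ω) (fun τ => R.eta τ i ω) (t - 1)
          - noiseSum (fun τ => R.chosen τ i ω) (fun τ => R.eta τ i ω) (lastSync m d T t)) := by
  have hst := lastSync_lt (m := m) (d := d) (T := T) ht
  have h1 : noiseSum (fun τ => R.chosen τ i ω) (fun τ => R.eta τ i ω) (t - 1)
      - noiseSum (fun τ => R.chosen τ i ω) (fun τ => R.eta τ i ω) (lastSync m d T t)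
      = ∑ τ ∈ Finset.Ico (lastSync m d T t + 1) t, R.eta τ i ω • R.chosen τ i ω := by
    rw [noiseSum, noiseSum, ← sum_Icc_add_sum_Ico _ hst, add_sub_cancel_left]
  -- Subtracting the Gram term times θ* removes the true mean from the observed reward and leaves
  -- the noise.
  have h2 : ∀ τ j, R.reward θstar τ j ω • R.chosen τ j ω
      - Matrix.vecMulVec (R.chosen τ j ω) (R.chosen τ j ω) *ᵥ θstar
      = R.eta τ j ω • R.chosen τ j ω := by
    intro τ j
    rw [Matrix.vecMulVec_mulVec, reward, dotProduct_comm]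
    ext l
    simp
    ring
  rw [h1]
  simp only [V, b, if_neg h, privGram, privVec, Matrix.add_mulVec, Matrix.sum_mulVec, noiseSum]
  rw [add_sub_add_comm, ← Finset.sum_sub_distrib, ← Finset.sum_sub_distrib]
  congr 1
  · refine Finset.sum_congr rfl fun j _ => ?_
    rw [add_sub_add_comm, ← Finset.sum_sub_distrib]
    simp only [h2]
    abel
  · simp only [h2]

/-- The error of the least squares estimates, in a round after the first synchronisation. -/
lemma matNorm_thetaHat_sub_le {ρlo ρhi z c N : ℝ} (hρ : 0 < ρlo) (hc : ‖WithLp.toLp 2 θstar‖ ≤ c)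
    (hN : 0 ≤ N) (hm : 1 ≤ m) (ht : t ∈ Finset.Icc 1 T) (h : lastSync m d T t ≠ 0)
    (hnoise : ∀ j, NoiseWithin ρlo ρhi z (R.H (lastSync m d T t) j ω)
      (R.h (lastSync m d T t) j ω))
    (hconf : ∀ k ≤ T, ∑ j, R.noiseNormSq ρlo k j ω ≤ m * N ^ 2) :
    (R.V T lam t i ω).PosDef ∧
    (∀ v, matNorm (regGram (m * ρlo) (fun τ => R.chosen τ i ω) (t - 1)) v
      ≤ matNorm (R.V T lam t i ω) v) ∧
    matNorm (R.V T lam t i ω) (R.thetaHat T lam θstar t i ω - θstar)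
      ≤ 3 * √m * N + m * c * √ρhi + m * z := by
  obtain ⟨ht1, htT⟩ := Finset.mem_Icc.1 ht
  have hst := lastSync_lt (m := m) (d := d) (T := T) ht1
  have hm' : (1 : ℝ) ≤ m := by exact_mod_cast hm
  set s := lastSync m d T t with hs
  set V := R.V T lam t i ω with hV
  have hHlo : ∀ j v, ρlo * (v ⬝ᵥ v) ≤ v ⬝ᵥ R.H s j ω *ᵥ v := by
    intro j v
    have := (hnoise j).lower.quad_nonneg v
    rw [Matrix.sub_mulVec, Matrix.smul_mulVec, Matrix.one_mulVec, dotProduct_sub,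
      dotProduct_smul, smul_eq_mul] at this
    linarith
  have hHhi : ∀ j v, v ⬝ᵥ R.H s j ω *ᵥ v ≤ ρhi * (v ⬝ᵥ v) := by
    intro j v
    have := (hnoise j).upper.quad_nonneg v
    rw [Matrix.sub_mulVec, Matrix.smul_mulVec, Matrix.one_mulVec, dotProduct_sub,
      dotProduct_smul, smul_eq_mul] at this
    linarith
  have hvv : ∀ v : Fin d → ℝ, 0 ≤ v ⬝ᵥ v := fun v => by rw [← norm_toLp_sq]; positivity
  have hHpos : ∀ j, (R.H s j ω).PosDef := by
    intro j
    have := (smul_one_posDef (d := d) hρ).add_posSemidef (hnoise j).lower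
    rwa [add_sub_cancel] at this
  have hsq : ∀ (S : Finset ℕ) v j, 0 ≤ ∑ τ ∈ S, (v ⬝ᵥ R.chosen τ j ω) ^ 2 :=
    fun S v j => Finset.sum_nonneg fun _ _ => sq_nonneg _
  have hquad : ∀ v, v ⬝ᵥ V *ᵥ v =
      ∑ j, (∑ τ ∈ Finset.Icc 1 s, (v ⬝ᵥ R.chosen τ j ω) ^ 2 + v ⬝ᵥ R.H s j ω *ᵥ v)
        + ∑ τ ∈ Finset.Ico (s + 1) t, (v ⬝ᵥ R.chosen τ i ω) ^ 2 := fun v => quad_V h v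
  have hHV : ∀ j v, v ⬝ᵥ R.H s j ω *ᵥ v ≤ v ⬝ᵥ V *ᵥ v := by
    intro j v
    rw [hquad]
    have h1 := Finset.single_le_sum (f := fun j => ∑ τ ∈ Finset.Icc 1 s,
      (v ⬝ᵥ R.chosen τ j ω) ^ 2 + v ⬝ᵥ R.H s j ω *ᵥ v) (fun j _ => add_nonneg (hsq _ v j)
      ((hHpos j).posSemidef.quad_nonneg v)) (Finset.mem_univ j)
    linarith [hsq (Finset.Icc 1 s) v j, hsq (Finset.Ico (s + 1) t) v i]
  -- Of the shared data only those of agent i are kept, but all m perturbations are.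
  have hWV : ∀ v, v ⬝ᵥ regGram (m * ρlo) (fun τ => R.chosen τ i ω) (t - 1) *ᵥ v
      ≤ v ⬝ᵥ V *ᵥ v := by
    intro v
    rw [quad_regGram, hquad, ← sum_Icc_add_sum_Ico _ hst, Finset.sum_add_distrib]
    have h1 := Finset.single_le_sum (f := fun j => ∑ τ ∈ Finset.Icc 1 s,
      (v ⬝ᵥ R.chosen τ j ω) ^ 2) (fun j _ => hsq _ v j) (Finset.mem_univ i)
    have h2 : m * ρlo * (v ⬝ᵥ v) ≤ ∑ j, v ⬝ᵥ R.H s j ω *ᵥ v := by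
      have := Finset.sum_le_sum fun j (_ : j ∈ Finset.univ) => hHlo j v
      simp at this
      linarith
    linarith
  -- Each H_j supplies the regulariser of its own agent, so the matrices of all agents fit below V
  -- simultaneously.
  have hAV : ∀ v, ∑ j, v ⬝ᵥ regGram ρlo (fun τ => R.chosen τ j ω) s *ᵥ v ≤ v ⬝ᵥ V *ᵥ v := by
    intro v
    rw [hquad]
    refine le_add_of_le_of_nonneg (Finset.sum_le_sum fun j _ => ?_) (hsq _ v i)
    rw [quad_regGram]
    linarith [hHlo j v]
  have hGV : ∀ v, v ⬝ᵥ regGram ρlo (fun τ => R.chosen τ i ω) (t - 1) *ᵥ v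
      ≤ v ⬝ᵥ V *ᵥ v := by
    intro v
    refine le_trans ?_ (hWV v)
    rw [quad_regGram, quad_regGram]
    have : ρlo * (v ⬝ᵥ v) ≤ m * ρlo * (v ⬝ᵥ v) := by
      have := mul_nonneg hρ.le (hvv v)
      nlinarith
    linarith
  have hGsV : ∀ v, v ⬝ᵥ regGram ρlo (fun τ => R.chosen τ i ω) s *ᵥ v ≤ v ⬝ᵥ V *ᵥ v := by
    intro v
    refine le_trans ?_ (hAV v)
    exact Finset.single_le_sum (f := fun j => v ⬝ᵥ regGram ρlo (fun τ => R.chosen τ j ω) s *ᵥ v)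
      (fun j _ => (regGram_posDef hρ s).posSemidef.quad_nonneg v) (Finset.mem_univ i)
  have hVsymm : Vᵀ = V := V_transpose h fun j => (hHpos j).posSemidef.transpose_eq
  have hVpos : V.PosDef := posDef_of_symm_of_pos hVsymm fun v hv => by
    have h1 := (hHpos i).dotProduct_mulVec_pos hv
    rw [star_trivial] at h1
    exact h1.trans_le (hHV i v)
  refine ⟨hVpos, fun v => matNorm_le_matNorm hWV v, ?_⟩
  have hc0 : 0 ≤ c := (norm_nonneg _).trans hc
  set e := R.thetaHat T lam θstar t i ω - θstar with he
  have hVe : V *ᵥ e = R.b T θstar t i ω - V *ᵥ θstar := by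
    rw [he, Matrix.mulVec_sub, thetaHat, hVpos.mulVec_inv_mulVec]
  set E := matNorm V e with hE
  have hE0 : 0 ≤ E := matNorm_nonneg _ _
  have hQ0 : ∀ k j, 0 ≤ R.noiseNormSq ρlo k j ω := fun k j =>
    (regGram_posDef hρ k).inv.posSemidef.quad_nonneg _
  -- Only the sum over the agents is controlled, so a single agent may account for all of it: this
  -- is the √m for the own noise.
  have hQi : ∀ k ≤ T, √(R.noiseNormSq ρlo k i ω) ≤ √m * N := by
    intro k hk
    rw [← Real.sqrt_sq hN, ← Real.sqrt_mul (by positivity)]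
    refine Real.sqrt_le_sqrt (le_trans ?_ (hconf k hk))
    exact Finset.single_le_sum (fun j _ => hQ0 k j) (Finset.mem_univ i)
  have hown : ∀ k ≤ T, (∀ v, v ⬝ᵥ regGram ρlo (fun τ => R.chosen τ i ω) k *ᵥ v
      ≤ v ⬝ᵥ V *ᵥ v) →
      |e ⬝ᵥ noiseSum (fun τ => R.chosen τ i ω) (fun τ => R.eta τ i ω) k| ≤ E * (√m * N) := by
    intro k hk hle
    refine (abs_dotProduct_le_matNorm_mul (regGram_posDef (x := fun τ => R.chosen τ i ω) hρ k)
      _ _).trans ?_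
    exact mul_le_mul (matNorm_le_matNorm hle e) (hQi k hk) (matNorm_nonneg _ _) hE0
  have hshared : ∑ j, e ⬝ᵥ noiseSum (fun τ => R.chosen τ j ω) (fun τ => R.eta τ j ω) s
      ≤ E * (√m * N) := by
    have h1 : ∀ j, e ⬝ᵥ noiseSum (fun τ => R.chosen τ j ω) (fun τ => R.eta τ j ω) s
        ≤ √(e ⬝ᵥ regGram ρlo (fun τ => R.chosen τ j ω) s *ᵥ e) * √(R.noiseNormSq ρlo s j ω) :=
      fun j => (le_abs_self _).trans (abs_dotProduct_le_matNorm_mul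
        (regGram_posDef (x := fun τ => R.chosen τ j ω) hρ s) _ _)
    refine (Finset.sum_le_sum fun j _ => h1 j).trans ?_
    refine (Real.sum_sqrt_mul_sqrt_le _
      (fun j => (regGram_posDef hρ s).posSemidef.quad_nonneg e) (fun j => hQ0 s j)).trans ?_
    refine mul_le_mul (Real.sqrt_le_sqrt (hAV e)) ?_ (Real.sqrt_nonneg _) hE0
    calc _ ≤ √(m * N ^ 2) := Real.sqrt_le_sqrt (hconf s (by omega))
      _ = _ := by rw [Real.sqrt_mul (by positivity), Real.sqrt_sq hN]
  have hh : ∀ j, e ⬝ᵥ R.h s j ω ≤ E * z := by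
    intro j
    refine (le_abs_self _).trans ((abs_dotProduct_le_matNorm_mul (hHpos j) _ _).trans ?_)
    exact mul_le_mul (matNorm_le_matNorm (hHV j) e) (hnoise j).vec (matNorm_nonneg _ _) hE0
  have hH : ∀ j, -(e ⬝ᵥ R.H s j ω *ᵥ θstar) ≤ E * (c * √ρhi) := by
    intro j
    refine (neg_le_abs _).trans ((abs_dotProduct_le_matNorm_mul (hHpos j) _ _).trans ?_)
    rw [matNorm_inv_mulVec (hHpos j)]
    refine mul_le_mul (matNorm_le_matNorm (hHV j) e) ?_ (matNorm_nonneg _ _) hE0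
    rw [matNorm, mul_comm]
    have h1 := hHhi j θstar
    rw [← norm_toLp_sq] at h1
    calc _ ≤ √(ρhi * ‖WithLp.toLp 2 θstar‖ ^ 2) := Real.sqrt_le_sqrt h1
      _ = √ρhi * ‖WithLp.toLp 2 θstar‖ := by
        rw [Real.sqrt_mul' _ (by positivity), Real.sqrt_sq (norm_nonneg _)]
      _ ≤ √ρhi * c := by gcongr
  -- E² = e·Ve. The three noise contributions are the shared one at s and the agent's own ones at t
  -- - 1 and at s, whose difference is the noise since s.
  have hmain : E ^ 2 ≤ E * (3 * √m * N + m * c * √ρhi + m * z) := by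
    rw [hE, sq_matNorm hVpos.posSemidef, hVe, hV, b_sub_V_mulVec h ht1]
    simp only [dotProduct_add, dotProduct_sub, dotProduct_sum, Finset.sum_add_distrib,
      Finset.sum_sub_distrib]
    have h1 := (le_abs_self _).trans (hown (t - 1) (by omega) hGV)
    have h2 := (neg_le_abs _).trans (hown s (by omega) hGsV)
    have h3 := Finset.sum_le_sum fun j (_ : j ∈ Finset.univ) => hh j
    have h4 := Finset.sum_le_sum fun j (_ : j ∈ Finset.univ) => hH j
    simp only [Finset.sum_const, Finset.card_univ, Fintype.card_fin, nsmul_eq_mul,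
      Finset.sum_neg_distrib] at h3 h4
    rw [← hs]
    change _ ≤ E * _
    linarith
  rcases hE0.eq_or_lt with h0 | h0
  · rw [← h0]
    have hz : 0 ≤ z := (matNorm_nonneg _ _).trans (hnoise i).vec
    positivity
  · rw [sq] at hmain
    exact le_of_mul_le_mul_left hmain h0

/-- In all rounds, the optimistic parameters are close to the true one in the norm of the
agent's own regularised Gram matrix. -/
lemma IsPrivFairX.matNorm_sub_theta_le [Fintype D] {mΩ : MeasurableSpace Ω} {P : Measure Ω}
    {ℱ : Filtration ℕ mΩ} {f : Fin m → ℝ → ℝ} {σ : ℝ≥0} {α ρlo ρhi z c : ℝ}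
    (hR : R.IsPrivFairX P ℱ T lam f θstar σ (sqrtBeta m d σ α c ρlo ρhi z))
    (hρ : 0 < ρlo) (hρ' : ρlo ≤ ρhi) (hlam : m * ρlo ≤ lam) (hc : ‖WithLp.toLp 2 θstar‖ ≤ c)
    (hα : 0 < α) (hα1 : α < 1) (hm : 1 ≤ m) (ht : t ∈ Finset.Icc 1 T)
    (hnoise : ∀ s ∈ syncRounds m d T, ∀ j, NoiseWithin ρlo ρhi z (R.H s j ω) (R.h s j ω))
    (hconf : ∀ k ≤ T, ∑ j, R.noiseNormSq ρlo k j ω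
      ≤ m * (σ ^ 2 * (2 * Real.log (2 / α) + d * Real.log (1 + T / (d * ρlo))))) :
    matNorm (regGram (m * ρlo) (fun τ => R.chosen τ i ω) (t - 1)) (θstar - R.theta t i ω)
      ≤ 4 * √m * sqrtBeta m d σ α c ρlo ρhi z T := by
  obtain ⟨ht1, htT⟩ := Finset.mem_Icc.1 ht
  have hm' : (1 : ℝ) ≤ m := by exact_mod_cast hm
  have hsm : 1 ≤ √(m : ℝ) := Real.one_le_sqrt.2 hm'
  have hc0 : 0 ≤ c := (norm_nonneg _).trans hc
  have hz : 0 ≤ z := (matNorm_nonneg _ _).trans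
    (hnoise 1 (one_mem_syncRounds (ht1.trans htT)) i).vec
  set N := σ * √(2 * Real.log (2 / α) + d * Real.log (ρhi / ρlo + T / (d * ρlo))) with hNdef
  have hN : 0 ≤ N := by positivity
  have hβ : sqrtBeta m d σ α c ρlo ρhi z T = N + m * c * √ρhi + m * z := rfl
  have hβt := sqrtBeta_mono (m := m) (d := d) (α := α) (c := c) (z := z) σ.coe_nonneg hρ hρ' htT
  have hmρ : 0 < m * ρlo := by positivity
  -- Only round 1 has no earlier synchronisation. There the estimate is 0 and V = λ I, so ‖θ*‖
  -- itself is the error, and the term mc√ρhi of the radius covers it.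
  by_cases h : lastSync m d T t = 0
  · have ht' : t = 1 := by
      by_contra hne
      exact lastSync_ne_zero (ht1.trans htT) (by omega) h
    subst ht'
    have hV : R.V T lam 1 i ω = lam • (1 : Matrix (Fin d) (Fin d) ℝ) := by
      simp [V, h]
    have hth : R.thetaHat T lam θstar 1 i ω = 0 := by
      simp [thetaHat, b, h]
    have hpos : (R.V T lam 1 i ω).PosDef := by
      rw [hV]; exact smul_one_posDef (hmρ.trans_le hlam)
    have h1 := (hR.optimistic 1 ht i ω hpos).1
    rw [confRegion, Set.mem_ofPred_eq, hth, sub_zero, hV,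
      matNorm_smul_one (hmρ.le.trans hlam)] at h1
    rw [regGram_zero, sub_eq_add_neg]
    refine (matNorm_add_le (smul_one_posDef hmρ) _ _).trans ?_
    rw [matNorm_neg, matNorm_smul_one hmρ.le, matNorm_smul_one hmρ.le]
    have h2 : √(m * ρlo) * ‖WithLp.toLp 2 (R.theta 1 i ω)‖
        ≤ √lam * ‖WithLp.toLp 2 (R.theta 1 i ω)‖ := by gcongr
    have h3 : √(m * ρlo) * ‖WithLp.toLp 2 θstar‖ ≤ m * c * √ρhi := by
      rw [Real.sqrt_mul (by positivity)]
      have : √(m : ℝ) ≤ m := Real.sqrt_le_iff.2 ⟨by linarith, by nlinarith⟩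
      calc √(m : ℝ) * √ρlo * ‖WithLp.toLp 2 θstar‖ ≤ m * √ρhi * c := by gcongr
        _ = _ := by ring
    have h4 : 0 ≤ m * z := by positivity
    have h5 : 0 ≤ sqrtBeta m d σ α c ρlo ρhi z T := by rw [hβ]; positivity
    nlinarith
  · have hconf' : ∀ k ≤ T, ∑ j, R.noiseNormSq ρlo k j ω ≤ m * N ^ 2 := by
      intro k hk
      refine (hconf k hk).trans ?_
      have h1 : 1 ≤ ρhi / ρlo := (one_le_div hρ).2 hρ'
      have h2 : Real.log (1 + T / (d * ρlo)) ≤ Real.log (ρhi / ρlo + T / (d * ρlo)) := by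
        gcongr
      have h3 : 0 ≤ Real.log (2 / α) :=
        Real.log_nonneg ((one_le_div hα).2 (by linarith))
      have h4 : 0 ≤ Real.log (ρhi / ρlo + T / (d * ρlo)) :=
        Real.log_nonneg (h1.trans (le_add_of_nonneg_right (by positivity)))
      rw [hNdef, mul_pow, Real.sq_sqrt (by positivity)]
      gcongr
    obtain ⟨hpos, hle, herr⟩ := matNorm_thetaHat_sub_le (R := R) (lam := lam) (i := i) hρ hc hN hm
      ht h (fun j => hnoise _ (lastSync_mem h) j) hconf'
    have h1 : matNorm (R.V T lam t i ω) (R.theta t i ω - R.thetaHat T lam θstar t i ω)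
        ≤ sqrtBeta m d σ α c ρlo ρhi z t := (hR.optimistic t ht i ω hpos).1
    refine (hle _).trans ?_
    have h2 := matNorm_add_le hpos (θstar - R.thetaHat T lam θstar t i ω)
      (R.thetaHat T lam θstar t i ω - R.theta t i ω)
    rw [sub_add_sub_cancel, matNorm_sub_comm _ θstar (R.thetaHat T lam θstar t i ω),
      matNorm_sub_comm _ (R.thetaHat T lam θstar t i ω) (R.theta t i ω)] at h2
    have h3 : 0 ≤ m * c * √ρhi := by positivity
    have h4 : 0 ≤ m * z := by positivity
    rw [hβ] at hβt ⊢
    nlinarith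

end Run

/-! ### The widths of the chosen contexts -/

lemma measurable_dotProduct {Ω : Type*} {mΩ : MeasurableSpace Ω} {d : ℕ} {v w : Ω → Fin d → ℝ}
    (hv : Measurable v) (hw : Measurable w) : Measurable fun ω => v ω ⬝ᵥ w ω := by
  simp only [dotProduct]
  exact Finset.measurable_sum _ fun i _ => ((measurable_pi_apply i).comp hv).mul
    ((measurable_pi_apply i).comp hw)

/-- The marginals of a product of probability vectors. -/
lemma sum_prod_filter_eq {ι D : Type*} [Fintype ι] [Fintype D] [DecidableEq ι] [DecidableEq D]
    (p : ι → D → ℝ) (hp : ∀ j, ∑ a, p j a = 1) (i : ι) (a : D) :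
    ∑ arms : ι → D with arms i = a, ∏ j, p j (arms j) = p i a := by
  have h1 : (Finset.univ.filter fun arms : ι → D => arms i = a)
      = Fintype.piFinset fun j => if j = i then {a} else Finset.univ := by
    ext arms
    simp only [Finset.mem_filter, Finset.mem_univ, true_and, Fintype.mem_piFinset]
    constructor
    · rintro h j
      split_ifs with hj
      · subst hj; simpa using h
      · simp
    · intro h
      simpa using h i
  rw [h1, ← Finset.prod_univ_sum, Finset.prod_eq_single i]
  · simp
  · intro j _ hj
    simp [hj, hp j]
  · simp

namespace Run

variable {Ω D : Type*} {m d : ℕ} {R : Run Ω D m d} {T : ℕ}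

/-- The width of the confidence ellipsoid of an agent who learns alone, with regularisation `ρ`,
in the direction of the context of arm `a`. -/
def width (R : Run Ω D m d) (ρ : ℝ) (t : ℕ) (i : Fin m) (ω : Ω) (a : D) : ℝ :=
  matNorm (regGram ρ (fun τ => R.chosen τ i ω) (t - 1))⁻¹ (R.ctx t i a ω)

lemma width_nonneg (ρ : ℝ) (t : ℕ) (i : Fin m) (ω : Ω) (a : D) : 0 ≤ R.width ρ t i ω a :=
  matNorm_nonneg _ _

/-- Supplies the range of the variables in the concentration inequality. -/
lemma width_le {ρ : ℝ} (hρ : 0 < ρ) {t : ℕ} {i : Fin m} {ω : Ω} {a : D}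
    (hx : ‖WithLp.toLp 2 (R.ctx t i a ω)‖ ≤ 1) : R.width ρ t i ω a ≤ 1 / √ρ := by
  rw [← Real.sqrt_one, ← Real.sqrt_div zero_le_one]
  refine Real.sqrt_le_sqrt (quad_inv_regGram_le hρ _ ?_)
  rw [← norm_toLp_sq]
  exact pow_le_one₀ (norm_nonneg _) hx

variable [Fintype D] {mΩ : MeasurableSpace Ω} {P : Measure Ω} {ℱ : Filtration ℕ mΩ}
  {lam : ℝ} {f : Fin m → ℝ → ℝ} {θstar : Fin d → ℝ} {σ : ℝ≥0} {rad : ℕ → ℝ} {γ L : ℝ}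

lemma IsPrivFairX.measurable_width (hR : R.IsPrivFairX P ℱ T lam f θstar σ rad) (ρ : ℝ) {t : ℕ}
    (ht : t ∈ Finset.Icc 1 T) (i : Fin m) (a : D) :
    Measurable[ℱ t] fun ω => R.width ρ t i ω a := by
  obtain ⟨ht1, htT⟩ := Finset.mem_Icc.1 ht
  refine measurable_matNorm_inv (measurable_regGram_apply ρ (x := fun τ => R.chosen τ i)
    fun τ hτ => ?_) (hR.meas_ctx t ht i a)
  obtain ⟨hτ1, hτ2⟩ := Finset.mem_Icc.1 hτ
  exact (hR.measurable_chosen (Finset.mem_Icc.2 ⟨hτ1, by omega⟩) i).mono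
    (ℱ.mono (by omega)) le_rfl

lemma IsPrivFairX.measurable_policy (hR : R.IsPrivFairX P ℱ T lam f θstar σ rad) (hL : 0 < L)
    (hf : ∀ i, IsMerit γ L (f i)) {t : ℕ} (ht : t ∈ Finset.Icc 1 T) (i : Fin m) (a : D) :
    Measurable[ℱ t] fun ω => R.policy f t i ω a := by
  have h1 : ∀ a, Measurable[ℱ t] fun ω => f i (R.theta t i ω ⬝ᵥ R.ctx t i a ω) := fun a =>
    ((hf i).continuous hL).measurable.comp
      (measurable_dotProduct (hR.meas_theta t ht i) (hR.meas_ctx t ht i a))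
  exact (h1 a).div (Finset.measurable_sum _ fun a' _ => h1 a')

lemma IsPrivFairX.measurableSet_act (hR : R.IsPrivFairX P ℱ T lam f θstar σ rad) {t : ℕ}
    (ht : t ∈ Finset.Icc 1 T) (i : Fin m) (a : D) : MeasurableSet {ω | R.act t i ω = a} :=
  ℱ.le _ _ (hR.meas_act t ht i (MeasurableSpace.measurableSet_top (s := {a})))

lemma policy_nonneg (hγ : 0 < γ) (hf : ∀ i, IsMerit γ L (f i)) (t : ℕ) (i : Fin m) (ω : Ω)
    (a : D) : 0 ≤ R.policy f t i ω a :=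
  (hf i).meritPolicy_nonneg hγ _ _ _

lemma sum_policy [Nonempty D] (hγ : 0 < γ) (hf : ∀ i, IsMerit γ L (f i)) (t : ℕ) (i : Fin m)
    (ω : Ω) : ∑ a, R.policy f t i ω a = 1 :=
  (hf i).sum_meritPolicy hγ _ _

lemma policy_le_one [Nonempty D] (hγ : 0 < γ) (hf : ∀ i, IsMerit γ L (f i)) (t : ℕ) (i : Fin m)
    (ω : Ω) (a : D) : R.policy f t i ω a ≤ 1 := by
  rw [← R.sum_policy hγ hf t i ω]
  exact Finset.single_le_sum (fun a _ => R.policy_nonneg hγ hf t i ω a) (Finset.mem_univ a)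

open Classical in
/-- Given the past, agent `i` draws arm `a` with probability `policy f t i ω a`. -/
lemma IsPrivFairX.integral_mul_ite_act [IsProbabilityMeasure P] [Nonempty D]
    (hR : R.IsPrivFairX P ℱ T lam f θstar σ rad) (hγ : 0 < γ) (hL : 0 < L)
    (hf : ∀ i, IsMerit γ L (f i)) {t : ℕ} (ht : t ∈ Finset.Icc 1 T) (i : Fin m) (a : D)
    {Y : Ω → ℝ} (hY : Measurable[ℱ t] Y) {B : ℝ} (hB : ∀ ω, |Y ω| ≤ B) :
    ∫ ω, Y ω * (if R.act t i ω = a then 1 else 0) ∂P = ∫ ω, Y ω * R.policy f t i ω a ∂P := by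
  set A : (Fin m → D) → Set Ω := fun arms => {ω | ∀ j, R.act t j ω = arms j} with hA
  have hAm : ∀ arms, MeasurableSet (A arms) := fun arms => by
    have : A arms = ⋂ j, {ω | R.act t j ω = arms j} := by ext; simp [hA]
    rw [this]
    exact MeasurableSet.iInter fun j => hR.measurableSet_act ht j _
  have hYm : Measurable Y := hY.mono (ℱ.le t) le_rfl
  have hind : ∀ arms, Integrable ((A arms).indicator fun _ => (1 : ℝ)) P := fun arms =>
    (integrable_const 1).indicator (hAm arms)
  have hYi : ∀ {Z : Ω → ℝ}, Measurable Z → (∀ ω, |Z ω| ≤ 1) →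
      Integrable (fun ω => Y ω * Z ω) P := fun {Z} hZ hZ1 =>
    Integrable.of_bound (hYm.mul hZ).aestronglyMeasurable (B * 1) (ae_of_all _ fun ω => by
      rw [Real.norm_eq_abs, abs_mul]
      exact mul_le_mul (hB ω) (hZ1 ω) (abs_nonneg _) ((abs_nonneg _).trans (hB ω)))
  have hpm : ∀ arms : Fin m → D, Measurable fun ω => ∏ j, R.policy f t j ω (arms j) := fun arms =>
    Finset.measurable_prod _ fun j _ => (hR.measurable_policy hL hf ht j _).mono (ℱ.le t) le_rfl
  have hp1 : ∀ (arms : Fin m → D) ω, |∏ j, R.policy f t j ω (arms j)| ≤ 1 := fun arms ω => by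
    rw [abs_of_nonneg (Finset.prod_nonneg fun j _ => R.policy_nonneg hγ hf t j ω _)]
    exact Finset.prod_le_one (fun j _ => R.policy_nonneg hγ hf t j ω _)
      fun j _ => R.policy_le_one hγ hf t j ω _
  have harms : ∀ arms, ∫ ω, Y ω * (A arms).indicator (fun _ => (1 : ℝ)) ω ∂P
      = ∫ ω, Y ω * ∏ j, R.policy f t j ω (arms j) ∂P := by
    intro arms
    have h1 := condExp_stronglyMeasurable_mul_of_bound (μ := P) (ℱ.le t) hY.stronglyMeasurable
      (hind arms) B (ae_of_all _ hB)
    calc ∫ ω, Y ω * (A arms).indicator (fun _ => (1 : ℝ)) ω ∂P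
        = ∫ ω, (P[Y * (A arms).indicator (fun _ => (1 : ℝ)) | ℱ t]) ω ∂P :=
          (integral_condExp (ℱ.le t)).symm
      _ = ∫ ω, Y ω * ∏ j, R.policy f t j ω (arms j) ∂P := by
          refine integral_congr_ae ?_
          filter_upwards [h1, hR.sampling t ht arms] with ω h2 h3
          rw [h2, Pi.mul_apply, h3]
  -- The sampling law is joint over the agents. Exactly one vector of arms occurs, so the event for
  -- one agent splits over the vectors with i-th entry a.
  have hsum : ∀ ω, (if R.act t i ω = a then (1 : ℝ) else 0)
      = ∑ arms : Fin m → D with arms i = a, (A arms).indicator (fun _ => (1 : ℝ)) ω := by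
    intro ω
    have h1 : ∀ arms : Fin m → D, (A arms).indicator (fun _ => (1 : ℝ)) ω
        = if (fun j => R.act t j ω) = arms then 1 else 0 := by
      intro arms
      simp only [hA, Set.indicator_apply, Set.mem_ofPred_eq, funext_iff]
    simp only [h1]
    rw [Finset.sum_ite_eq]
    simp
  calc ∫ ω, Y ω * (if R.act t i ω = a then 1 else 0) ∂P
      = ∫ ω, ∑ arms : Fin m → D with arms i = a,
          Y ω * (A arms).indicator (fun _ => (1 : ℝ)) ω ∂P := by
        congr 1; ext ω
        rw [hsum, Finset.mul_sum]
    _ = ∑ arms : Fin m → D with arms i = a, ∫ ω, Y ω * ∏ j, R.policy f t j ω (arms j) ∂P := by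
        rw [integral_finsetSum _ fun arms _ => hYi (measurable_const.indicator (hAm arms))
          fun ω => ?_]
        · exact Finset.sum_congr rfl fun arms _ => harms arms
        · simp only [Set.indicator_apply]
          split_ifs <;> simp
    _ = ∫ ω, Y ω * R.policy f t i ω a ∂P := by
        rw [← integral_finsetSum _ fun arms _ => hYi (hpm arms) (hp1 arms)]
        congr 1; ext ω
        rw [← Finset.mul_sum, sum_prod_filter_eq (fun j => R.policy f t j ω)
          (fun j => R.sum_policy hγ hf t j ω)]

/-- The average over the agents of the widths of the contexts drawn in round `t`. -/
def meanWidth (R : Run Ω D m d) (ρ : ℝ) (t : ℕ) (ω : Ω) : ℝ :=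
  1 / (m : ℝ) * ∑ i, R.width ρ t i ω (R.act t i ω)

/-- The mean of `meanWidth`, given the past. -/
def expWidth (R : Run Ω D m d) (f : Fin m → ℝ → ℝ) (ρ : ℝ) (t : ℕ) (ω : Ω) : ℝ :=
  1 / (m : ℝ) * ∑ i, ∑ a, R.policy f t i ω a * R.width ρ t i ω a

lemma mean_mem_Icc (hm : 1 ≤ m) {K : ℝ} {y : Fin m → ℝ} (hy : ∀ i, y i ∈ Set.Icc 0 K) :
    1 / (m : ℝ) * ∑ i, y i ∈ Set.Icc 0 K := by
  have hm' : (0 : ℝ) < m := by exact_mod_cast hm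
  refine ⟨mul_nonneg (by positivity) (Finset.sum_nonneg fun i _ => (hy i).1), ?_⟩
  have := Finset.sum_le_sum fun i (_ : i ∈ Finset.univ) => (hy i).2
  simp only [Finset.sum_const, Finset.card_univ, Fintype.card_fin, nsmul_eq_mul] at this
  rw [one_div, inv_mul_le_iff₀ hm']
  exact this

/-- With high probability, the widths in all rounds are close to their conditional means. -/
lemma IsPrivFairX.measureReal_sum_meanWidth_le [IsProbabilityMeasure P] [Nonempty D]
    (hR : R.IsPrivFairX P ℱ T lam f θstar σ rad) (hγ : 0 < γ) (hL : 0 < L)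
    (hf : ∀ i, IsMerit γ L (f i)) (hm : 1 ≤ m) (hT : 1 ≤ T) {ρ : ℝ} (hρ : 0 < ρ)
    (hx : ∀ t ∈ Finset.Icc 1 T, ∀ i a ω, ‖WithLp.toLp 2 (R.ctx t i a ω)‖ ≤ 1)
    {δ : ℝ} (hδ : 0 < δ) (hδ1 : δ < 1) :
    P.real {ω | ∑ t ∈ Finset.Icc 1 T, R.meanWidth ρ t ω + 1 / √ρ * √(2 * T * Real.log (1 / δ))
      ≤ ∑ t ∈ Finset.Icc 1 T, R.expWidth f ρ t ω} ≤ δ := by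
  classical
  have hw : ∀ t ∈ Finset.Icc 1 T, ∀ i a ω, R.width ρ t i ω a ∈ Set.Icc 0 (1 / √ρ) :=
    fun t ht i a ω => ⟨R.width_nonneg _ _ _ _ _, R.width_le hρ (hx t ht i a ω)⟩
  refine measureReal_sum_add_le_sum_le (ℱ := ℱ) hT (by positivity) (fun t ht => ?_)
    (fun t ht => ?_) (fun t ht ω => mean_mem_Icc hm fun i => hw t ht i _ ω)
    (fun t ht ω => mean_mem_Icc hm fun i => ⟨?_, ?_⟩) (fun t ht Y hY ⟨B, hB⟩ => ?_) hδ hδ1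
  · refine (Finset.measurable_sum _ fun i _ => ?_).const_mul _
    exact measurable_apply_of_finite (F := fun a ω => R.width ρ t i ω a)
      (fun a => (hR.measurable_width ρ ht i a).mono (ℱ.mono (by omega)) le_rfl)
      (hR.meas_act t ht i)
  · exact (Finset.measurable_sum _ fun i _ => Finset.measurable_sum _ fun a _ =>
      (hR.measurable_policy hL hf ht i a).mul (hR.measurable_width ρ ht i a)).const_mul _
  · exact Finset.sum_nonneg fun a _ => mul_nonneg (R.policy_nonneg hγ hf t i ω a) (hw t ht i a ω).1
  · calc ∑ a, R.policy f t i ω a * R.width ρ t i ω a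
        ≤ ∑ a, R.policy f t i ω a * (1 / √ρ) := Finset.sum_le_sum fun a _ =>
          mul_le_mul_of_nonneg_left (hw t ht i a ω).2 (R.policy_nonneg hγ hf t i ω a)
      _ = 1 / √ρ := by rw [← Finset.sum_mul, R.sum_policy hγ hf, one_mul]
  · have hYm : Measurable Y := hY.mono (ℱ.le t) le_rfl
    have hYw : ∀ i a, Measurable[ℱ t] fun ω => Y ω * R.width ρ t i ω a := fun i a =>
      hY.mul (hR.measurable_width ρ ht i a)
    have hYwb : ∀ i a ω, |Y ω * R.width ρ t i ω a| ≤ B * (1 / √ρ) := fun i a ω => by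
      rw [abs_mul, abs_of_nonneg (hw t ht i a ω).1]
      exact mul_le_mul (hB ω) (hw t ht i a ω).2 (hw t ht i a ω).1 ((abs_nonneg _).trans (hB ω))
    have hint : ∀ i a {Z : Ω → ℝ}, Measurable Z → (∀ ω, |Z ω| ≤ 1) →
        Integrable (fun ω => Y ω * R.width ρ t i ω a * Z ω) P := fun i a Z hZ hZ1 =>
      Integrable.of_bound (((hYw i a).mono (ℱ.le t) le_rfl).mul hZ).aestronglyMeasurable
        (B * (1 / √ρ) * 1) (ae_of_all _ fun ω => by
          rw [Real.norm_eq_abs, abs_mul]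
          exact mul_le_mul (hYwb i a ω) (hZ1 ω) (abs_nonneg _)
            ((abs_nonneg _).trans (hYwb i a ω)))
    have hI : ∀ i a, Integrable (fun ω => Y ω * R.width ρ t i ω a *
        (if R.act t i ω = a then (1 : ℝ) else 0)) P := fun i a =>
      hint i a (Measurable.ite (hR.measurableSet_act ht i a) measurable_const measurable_const)
        fun ω => by split_ifs <;> simp
    have hJ : ∀ i a, Integrable (fun ω => Y ω * R.width ρ t i ω a * R.policy f t i ω a) P :=
      fun i a => hint i a ((hR.measurable_policy hL hf ht i a).mono (ℱ.le t) le_rfl) fun ω => by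
        rw [abs_of_nonneg (R.policy_nonneg hγ hf t i ω a)]
        exact R.policy_le_one hγ hf t i ω a
    have e1 : ∀ ω, Y ω * R.meanWidth ρ t ω = 1 / (m : ℝ) * ∑ i, ∑ a,
        Y ω * R.width ρ t i ω a * (if R.act t i ω = a then (1 : ℝ) else 0) := by
      intro ω
      rw [meanWidth, mul_left_comm, Finset.mul_sum]
      simp
    have e2 : ∀ ω, Y ω * R.expWidth f ρ t ω = 1 / (m : ℝ) * ∑ i, ∑ a,
        Y ω * R.width ρ t i ω a * R.policy f t i ω a := by
      intro ω
      rw [expWidth, mul_left_comm, Finset.mul_sum]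
      congr 1
      refine Finset.sum_congr rfl fun i _ => ?_
      rw [Finset.mul_sum]
      exact Finset.sum_congr rfl fun a _ => by ring
    have e3 : ∫ ω, Y ω * R.meanWidth ρ t ω ∂P = ∫ ω, Y ω * R.expWidth f ρ t ω ∂P := by
      simp only [e1, e2]
      rw [integral_const_mul, integral_const_mul,
        integral_finsetSum _ fun i _ => integrable_finsetSum _ fun a _ => hI i a,
        integral_finsetSum _ fun i _ => integrable_finsetSum _ fun a _ => hJ i a]
      congr 1
      refine Finset.sum_congr rfl fun i _ => ?_
      rw [integral_finsetSum _ fun a _ => hI i a, integral_finsetSum _ fun a _ => hJ i a]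
      exact Finset.sum_congr rfl fun a _ =>
        hR.integral_mul_ite_act hγ hL hf ht i a (hYw i a) (hYwb i a)
    exact e3

/-- The elliptic potential bound, averaged over the agents. -/
lemma sum_meanWidth_le {D : Type*} {R : Run Ω D m d} {ρ r : ℝ} (hm : 1 ≤ m) (hd : 1 ≤ d) (hρ : 0 < ρ) (hr : 0 < r)
    (hrρ : r ≤ ρ) (hx : ∀ t ∈ Finset.Icc 1 T, ∀ i a ω, ‖WithLp.toLp 2 (R.ctx t i a ω)‖ ≤ 1)
    (ω : Ω) : ∑ t ∈ Finset.Icc 1 T, R.meanWidth ρ t ω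
      ≤ √((1 + 1 / r) * (T * d * Real.log (1 + T / (d * ρ)))) := by
  simp only [meanWidth]
  rw [← Finset.mul_sum, Finset.sum_comm]
  refine (mean_mem_Icc hm fun i => ⟨Finset.sum_nonneg fun t _ => R.width_nonneg _ _ _ _ _, ?_⟩).2
  refine sum_matNorm_inv_regGram_le (x := fun τ => R.chosen τ i ω) hρ hd hr hrρ fun t ht => ?_
  rw [← norm_toLp_sq]
  exact pow_le_one₀ (norm_nonneg _) (hx t ht i _ ω)

/-- The regret of a round is bounded by the mean width, if the optimistic parameter is close to
the true one. -/
lemma instRegret_le [Nonempty D] (hγ : 0 < γ) (hL : 0 < L) (hf : ∀ i, IsMerit γ L (f i)) {ρ b : ℝ}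
    (hρ : 0 < ρ) {t : ℕ} {i : Fin m} {ω : Ω}
    (hb : matNorm (regGram ρ (fun τ => R.chosen τ i ω) (t - 1)) (θstar - R.theta t i ω) ≤ b) :
    R.instRegret f θstar t i ω
      ≤ 2 * L / γ * b * ∑ a, R.policy f t i ω a * R.width ρ t i ω a := by
  refine ((hf i).sum_abs_meritPolicy_sub_le hγ _ (R.theta t i ω) θstar).trans ?_
  rw [mul_assoc]
  refine mul_le_mul_of_nonneg_left ?_ (by positivity)
  rw [Finset.mul_sum]
  refine Finset.sum_le_sum fun a _ => ?_
  rw [mul_left_comm]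
  refine mul_le_mul_of_nonneg_left ?_ (R.policy_nonneg hγ hf t i ω a)
  exact (abs_dotProduct_le_matNorm_mul (regGram_posDef hρ (t - 1)) _ _).trans
    (mul_le_mul_of_nonneg_right hb (R.width_nonneg _ _ _ _ _))

lemma fairnessRegret_le [Nonempty D] (hγ : 0 < γ) (hL : 0 < L) (hf : ∀ i, IsMerit γ L (f i))
    {ρ b : ℝ} (hρ : 0 < ρ) {ω : Ω} (hb : ∀ t ∈ Finset.Icc 1 T, ∀ i,
      matNorm (regGram ρ (fun τ => R.chosen τ i ω) (t - 1)) (θstar - R.theta t i ω) ≤ b) :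
    R.fairnessRegret f θstar T ω ≤ 2 * L / γ * b * ∑ t ∈ Finset.Icc 1 T, R.expWidth f ρ t ω := by
  simp only [fairnessRegret, expWidth]
  rw [← Finset.mul_sum, mul_left_comm, Finset.sum_comm]
  refine mul_le_mul_of_nonneg_left ?_ (by positivity)
  rw [Finset.mul_sum]
  refine Finset.sum_le_sum fun t ht => ?_
  rw [Finset.mul_sum]
  exact Finset.sum_le_sum fun i _ => instRegret_le hγ hL hf hρ (hb t ht i)

/-- The privatizer noise of all synchronisations is within the bounds with high probability. -/
lemma IsPrivFairX.measureReal_exists_not_noiseWithin [IsProbabilityMeasure P]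
    (hR : R.IsPrivFairX P ℱ T lam f θstar σ rad) (hm : 1 ≤ m) (hT : 1 ≤ T) {ρlo ρhi z α : ℝ}
    (h : R.NoiseAccurate P T ρlo ρhi z (α / (2 * (syncRounds m d T).card * m))) :
    P.real {ω | ∃ s ∈ syncRounds m d T, ∃ j,
      ¬ NoiseWithin ρlo ρhi z (R.H s j ω) (R.h s j ω)} ≤ α / 2 := by
  have hm' : (0 : ℝ) < m := by exact_mod_cast hm
  have hn : (0 : ℝ) < (syncRounds m d T).card := by
    exact_mod_cast Finset.card_pos.2 ⟨1, one_mem_syncRounds hT⟩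
  have hset : {ω | ∃ s ∈ syncRounds m d T, ∃ j,
      ¬ NoiseWithin ρlo ρhi z (R.H s j ω) (R.h s j ω)}
      = ⋃ p ∈ syncRounds m d T ×ˢ (Finset.univ : Finset (Fin m)),
        {ω | NoiseWithin ρlo ρhi z (R.H p.1 p.2 ω) (R.h p.1 p.2 ω)}ᶜ := by
    ext ω
    simp
  rw [hset]
  refine (measureReal_biUnion_finset_le _ _).trans ?_
  have h1 : ∀ p ∈ syncRounds m d T ×ˢ (Finset.univ : Finset (Fin m)),
      P.real {ω | NoiseWithin ρlo ρhi z (R.H p.1 p.2 ω) (R.h p.1 p.2 ω)}ᶜ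
        ≤ α / (2 * (syncRounds m d T).card * m) := by
    intro p hp
    have hs := (Finset.mem_product.1 hp).1
    have hs' : p.1 ∈ Finset.Icc 1 T := syncRounds_subset hs
    rw [probReal_compl_eq_one_sub (measurableSet_noiseWithin
      (fun k l => (hR.meas_H _ hs' p.2 k l).mono (ℱ.le 0) le_rfl)
      ((hR.meas_h _ hs' p.2).mono (ℱ.le 0) le_rfl))]
    linarith [h p.1 hs p.2]
  refine (Finset.sum_le_sum h1).trans (le_of_eq ?_)
  rw [Finset.sum_const, Finset.card_product, Finset.card_univ, Fintype.card_fin, nsmul_eq_mul]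
  push_cast
  field_simp

end Run

/-! ### Comparison with the claimed rate -/

/-- The sum of the potential and the deviation is of the order of the regret bound. -/
lemma sqrt_mul_add_le {m d T : ℕ} (hm : 1 ≤ m) (hd : 1 ≤ d) (hT : 1 ≤ T) {r ρlo ρhi δ : ℝ}
    (hr : 0 < r) (hρ : 0 < ρlo) (hρ' : ρlo ≤ ρhi) (hrρ : r ≤ m * ρlo) (hδ : 0 < δ) (hδ1 : δ < 1) :
    √m * (√((1 + 1 / r) * (T * d * Real.log (1 + T / (d * (m * ρlo)))))
        + 1 / √(m * ρlo) * √(2 * T * Real.log (1 / δ)))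
      ≤ 3 * √(1 + 1 / r) * √(Real.log (4 / δ)) *
        √(m * T * d * Real.log (ρhi / ρlo + T / (d * ρlo))
          + (m : ℝ) ^ 2 * (d : ℝ) ^ 3 * Real.log (ρhi / ρlo + T / (d * ρlo)) ^ 3) := by
  have hm' : (1 : ℝ) ≤ m := by exact_mod_cast hm
  have hd' : (1 : ℝ) ≤ d := by exact_mod_cast hd
  have hT' : (1 : ℝ) ≤ T := by exact_mod_cast hT
  have hm0 : (0 : ℝ) < m := by linarith
  have hd0 : (0 : ℝ) < d := by linarith
  have hT0 : (0 : ℝ) < T := by linarith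
  set x : ℝ := T / (d * ρlo) with hx
  have hx0 : 0 < x := by positivity
  set l := Real.log (ρhi / ρlo + x) with hl
  have hl1 : Real.log (1 + x) ≤ l := by
    have := (one_le_div hρ).2 hρ'
    rw [hl]; gcongr
  have hlx : x / (1 + x) ≤ Real.log (1 + x) := by
    have := Real.one_sub_inv_le_log_of_pos (show 0 < 1 + x by positivity)
    convert this using 1
    field_simp
    ring
  have hl0 : 0 ≤ l := le_trans (by positivity) (hlx.trans hl1)
  set Q := m * T * d * l with hQ
  have hQ0 : 0 ≤ Q := by positivity
  have hc : 0 < 1 + 1 / r := by positivity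
  have h1 : √m * √((1 + 1 / r) * (T * d * Real.log (1 + T / (d * (m * ρlo)))))
      ≤ √(1 + 1 / r) * √Q := by
    rw [← Real.sqrt_mul hm0.le, ← Real.sqrt_mul hc.le]
    apply Real.sqrt_le_sqrt
    have h2 : Real.log (1 + T / (d * (m * ρlo))) ≤ l := by
      refine le_trans ?_ hl1
      have : d * ρlo ≤ d * (m * ρlo) := by
        have := mul_pos hd0 hρ
        nlinarith
      rw [hx]
      gcongr
    calc (m : ℝ) * ((1 + 1 / r) * (T * d * Real.log (1 + T / (d * (m * ρlo)))))
        ≤ m * ((1 + 1 / r) * (T * d * l)) := by gcongr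
      _ = _ := by rw [hQ]; ring
  have hlog1 : 0 ≤ Real.log (1 / δ) := Real.log_nonneg ((one_le_div hδ).2 hδ1.le)
  have hlog4 : 1 ≤ Real.log (4 / δ) := by
    have e4 : Real.exp 1 ≤ 4 / δ := by
      have : Real.exp 1 < 4 := by linarith [Real.exp_one_lt_d9]
      refine this.le.trans ?_
      rw [le_div_iff₀ hδ]
      linarith
    exact (Real.le_log_iff_exp_le (by positivity)).2 e4
  have hlog14 : Real.log (1 / δ) ≤ Real.log (4 / δ) := by gcongr; norm_num
  -- The factor √m cancels against the regulariser mρlo, leaving √(2 log(1/δ) T/ρlo), which has to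
  -- be absorbed into Q.
  have h3 : √m * (1 / √(m * ρlo) * √(2 * T * Real.log (1 / δ)))
      ≤ √2 * √(Real.log (4 / δ)) * (√(1 + 1 / r) * √Q) := by
    have e : √(m : ℝ) * (1 / √(m * ρlo) * √(2 * T * Real.log (1 / δ)))
        = √(2 * Real.log (1 / δ) * (T / ρlo)) := by
      rw [Real.sqrt_mul hm0.le, show 2 * Real.log (1 / δ) * (T / ρlo)
        = 2 * T * Real.log (1 / δ) / ρlo by ring, Real.sqrt_div (by positivity)]
      have := Real.sqrt_pos.2 hm0
      have := Real.sqrt_pos.2 hρ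
      field_simp
    rw [e, ← Real.sqrt_mul hc.le, ← Real.sqrt_mul two_pos.le, ← Real.sqrt_mul (by positivity)]
    apply Real.sqrt_le_sqrt
    -- T/ρlo = dx, and x ≤ (1 + x) log(1 + x). Since mρlo ≥ r, the factor 1 + x is at most (1 +
    -- 1/r)mT, and the logarithm supplies the one in Q.
    have h4 : T / ρlo ≤ (1 + 1 / r) * Q := by
      have h5 : 1 + x ≤ (1 + 1 / r) * (m * T) := by
        have h6 : x ≤ 1 / r * (m * T) := by
          rw [hx, div_le_iff₀ (by positivity)]
          have : 1 ≤ 1 / r * (m * ρlo) := by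
            rw [one_div, ← div_eq_inv_mul, one_le_div hr]; exact hrρ
          calc (T : ℝ) = 1 * T * 1 := by ring
            _ ≤ (1 / r * (m * ρlo)) * T * d := by gcongr
            _ = _ := by ring
        nlinarith [mul_le_mul hm' hT' zero_le_one hm0.le]
      calc T / ρlo = d * x := by rw [hx]; field_simp
        _ = (1 + x) * (d * (x / (1 + x))) := by field_simp
        _ ≤ ((1 + 1 / r) * (m * T)) * (d * l) := by
          have := hlx.trans hl1
          gcongr
        _ = _ := by rw [hQ]; ring
    gcongr
  have hs2 : √(2 : ℝ) ≤ 2 := Real.sqrt_le_iff.2 ⟨by norm_num, by norm_num⟩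
  have hs4 : 1 ≤ √(Real.log (4 / δ)) := Real.one_le_sqrt.2 hlog4
  calc _ = √m * √((1 + 1 / r) * (T * d * Real.log (1 + T / (d * (m * ρlo)))))
        + √m * (1 / √(m * ρlo) * √(2 * T * Real.log (1 / δ))) := mul_add _ _ _
    _ ≤ 1 * (√(1 + 1 / r) * √Q) + √2 * √(Real.log (4 / δ)) * (√(1 + 1 / r) * √Q) := by
      linarith
    _ ≤ √(Real.log (4 / δ)) * (√(1 + 1 / r) * √Q)
        + 2 * √(Real.log (4 / δ)) * (√(1 + 1 / r) * √Q) := by gcongr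
    _ = 3 * √(1 + 1 / r) * √(Real.log (4 / δ)) * √Q := by ring
    _ ≤ _ := by
      gcongr
      exact le_add_of_nonneg_right (by positivity)

end FairBandit

end

/-! ### Assembly of the theorem -/

open FairBandit in
theorem theorem2 (r : ℝ) (hr : 0 < r) :
    ∃ C : ℝ, 0 < C ∧
      ∀ (m d T : ℕ) (_ : 1 ≤ m) (_ : 1 ≤ d) (_ : 1 ≤ T)
        (D : Type*) [Fintype D] [Nonempty D]
        (Ω : Type*) [mΩ : MeasurableSpace Ω] (P : Measure Ω) [IsProbabilityMeasure P]
        (ℱ : Filtration ℕ mΩ) (R : Run Ω D m d)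
        (γ L : ℝ) (_ : 0 < γ) (_ : 0 < L)
        (f : Fin m → ℝ → ℝ) (_ : ∀ i, IsMerit γ L (f i))
        (θstar : Fin d → ℝ) (c : ℝ) (_ : ‖WithLp.toLp 2 θstar‖ ≤ c)
        (σ : ℝ≥0) (α δ ν : ℝ) (_ : 0 < α) (_ : α < 1) (_ : 0 < δ) (_ : δ < 1) (_ : 1 < ν)
        (ρlo ρhi z lam : ℝ) (_ : 0 < ρlo) (_ : ρlo ≤ ρhi) (_ : r ≤ m * ρlo)
        (_ : m * ρlo ≤ lam)
        (_ : ∀ t ∈ Finset.Icc 1 T, ∀ i a ω, ‖WithLp.toLp 2 (R.ctx t i a ω)‖ ≤ 1)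
        (_ : R.IsPrivFairX P ℱ T lam f θstar σ (sqrtBeta m d σ α c ρlo ρhi z))
        (_ : R.NoiseAccurate P T ρlo ρhi z (α / (2 * (syncRounds m d T).card * m))),
        1 - α - δ ≤ P.real {ω | R.fairnessRegret f θstar T ω ≤
          C * √(Real.log (4 / δ)) *
            (4 * ν * L * sqrtBeta m d σ α c ρlo ρhi z T / γ *
              √(m * T * d * Real.log (ρhi / ρlo + T / (d * ρlo))
                + (m : ℝ) ^ 2 * (d : ℝ) ^ 3 * Real.log (ρhi / ρlo + T / (d * ρlo)) ^ 3))} := by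
  -- The policy estimate gives 2, the confidence radius 4, the final comparison 3√(1 + 1/r); of the
  -- product 24√(1 + 1/r) a factor 4 is displayed in the bound.
  refine ⟨6 * √(1 + 1 / r), by positivity, ?_⟩
  intro m d T hm hd hT D _ _ Ω mΩ P _ ℱ R γ L hγ hL f hf θstar c hc σ α δ ν hα hα1 hδ hδ1 hν
    ρlo ρhi z lam hρ hρ' hrρ hlam hx hR hacc
  have hm0 : (0 : ℝ) < m := by exact_mod_cast hm
  have hmρ : 0 < m * ρlo := by positivity
  have hB1 := hR.measureReal_exists_not_noiseWithin hm hT hacc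
  have hB2 := hR.measureReal_exists_lt_sum_noiseNormSq hρ hm hd hα
    fun t ht i ω => by
      rw [← norm_toLp_sq]
      exact pow_le_one₀ (norm_nonneg _) (hx t ht i _ ω)
  have hB3 := hR.measureReal_sum_meanWidth_le hγ hL hf hm hT hmρ hx hδ hδ1
  set B1 := {ω | ∃ s ∈ syncRounds m d T, ∃ j, ¬ NoiseWithin ρlo ρhi z (R.H s j ω) (R.h s j ω)}
  set B2 := {ω | ∃ k ≤ T, m * (σ ^ 2 * (2 * Real.log (2 / α) + d * Real.log (1 + T / (d * ρlo))))
    < ∑ j, R.noiseNormSq ρlo k j ω}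
  set B3 := {ω | ∑ t ∈ Finset.Icc 1 T, R.meanWidth (m * ρlo) t ω
    + 1 / √(m * ρlo) * √(2 * T * Real.log (1 / δ))
      ≤ ∑ t ∈ Finset.Icc 1 T, R.expWidth f (m * ρlo) t ω}
  set G := {ω | R.fairnessRegret f θstar T ω ≤
    6 * √(1 + 1 / r) * √(Real.log (4 / δ)) *
      (4 * ν * L * sqrtBeta m d σ α c ρlo ρhi z T / γ *
        √(m * T * d * Real.log (ρhi / ρlo + T / (d * ρlo))
          + (m : ℝ) ^ 2 * (d : ℝ) ^ 3 * Real.log (ρhi / ρlo + T / (d * ρlo)) ^ 3))} with hG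
  -- Covering the whole space and using subadditivity avoids proving `G` measurable.
  have hcover : Set.univ ⊆ G ∪ (B1 ∪ (B2 ∪ B3)) := by
    intro ω _
    by_contra hω
    simp only [Set.mem_union, not_or] at hω
    obtain ⟨hωG, h1, h2, h3⟩ := hω
    refine hωG ?_
    simp only [B1, B2, B3, Set.mem_ofPred_eq, not_exists, not_and, not_not, not_lt, not_le]
      at h1 h2 h3
    have hi : Fin m := ⟨0, hm⟩
    have hθ : ∀ t ∈ Finset.Icc 1 T, ∀ i, matNorm (regGram (m * ρlo) (fun τ => R.chosen τ i ω)
        (t - 1)) (θstar - R.theta t i ω) ≤ 4 * √m * sqrtBeta m d σ α c ρlo ρhi z T :=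
      fun t ht i => hR.matNorm_sub_theta_le hρ hρ' hlam hc hα hα1 hm ht h1 h2
    have hβ : 0 ≤ sqrtBeta m d σ α c ρlo ρhi z T := by
      have h4 := (matNorm_nonneg _ _).trans (hθ 1 (Finset.mem_Icc.2 ⟨le_rfl, hT⟩) hi)
      exact nonneg_of_mul_nonneg_right h4 (by positivity)
    set β := sqrtBeta m d σ α c ρlo ρhi z T
    have hreg := Run.fairnessRegret_le hγ hL hf hmρ hθ
    have hpot := Run.sum_meanWidth_le hm hd hmρ hr hrρ hx ω
    have hfin := sqrt_mul_add_le hm hd hT hr hρ hρ' hrρ hδ hδ1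
    set S := √(m * T * d * Real.log (ρhi / ρlo + T / (d * ρlo))
          + (m : ℝ) ^ 2 * (d : ℝ) ^ 3 * Real.log (ρhi / ρlo + T / (d * ρlo)) ^ 3)
    rw [hG, Set.mem_ofPred_eq]
    calc R.fairnessRegret f θstar T ω
        ≤ 2 * L / γ * (4 * √m * β) * ∑ t ∈ Finset.Icc 1 T, R.expWidth f (m * ρlo) t ω := hreg
      _ ≤ 2 * L / γ * (4 * √m * β) * (√((1 + 1 / r) * (T * d *
            Real.log (1 + T / (d * (m * ρlo))))) + 1 / √(m * ρlo) *
              √(2 * T * Real.log (1 / δ))) := by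
          gcongr
          linarith
      _ = 8 * L / γ * β * (√m * (√((1 + 1 / r) * (T * d *
            Real.log (1 + T / (d * (m * ρlo))))) + 1 / √(m * ρlo) *
              √(2 * T * Real.log (1 / δ)))) := by ring
      _ ≤ 8 * L / γ * β * (3 * √(1 + 1 / r) * √(Real.log (4 / δ)) * S) := by gcongr
      _ = 6 * √(1 + 1 / r) * √(Real.log (4 / δ)) * (4 * 1 * L * β / γ * S) := by ring
      _ ≤ 6 * √(1 + 1 / r) * √(Real.log (4 / δ)) * (4 * ν * L * β / γ * S) := by gcongr
  have h1 : (1 : ℝ) = P.real Set.univ := by simp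
  have h2 := measureReal_mono (μ := P) hcover
  have h3 := measureReal_union_le (μ := P) G (B1 ∪ (B2 ∪ B3))
  have h4 := measureReal_union_le (μ := P) B1 (B2 ∪ B3)
  have h5 := measureReal_union_le (μ := P) B2 B3
  linarith
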